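/- **Setting.** Let $\mathcal L$ be either the set of formulas of propositional logic over a set of atoms, or the set of sentences of first-order predicate logic without equality over an arbitrary signature, with connectives $\neg,\wedge,\vee,\to,\leftrightarrow,\bot$ (and $\forall,\exists$); $\top$ abbreviates $\neg\bot$. $\vdash$ is classical consequence: $\Gamma\vdash\varphi$ iff every interpretation (with non-empty domain) satisfying $\Gamma$ satisfies $\varphi$. A *defeasible rule* $\varphi\leadsto\psi$ consists of $\varphi\in\mathcal L$ and a *statement* $\psi$, which is either a proposition in $\mathcal L$ or a negated defeasible rule $\mathbf{not}(\eta\leadsto\mu)$. Let $\Sigma\subseteq\mathcal L$, let $D$ be a set of defeasible rules, whose members may in predicate logic contain free variables $\mathbf x$, and let $\overline D$ be the set of their ground instances (all free variables replaced by closed terms of the signature; $\overline D=D$ in propositional logic). For a set $\Gamma$ of statements, $\Gamma\vdash\varphi$ means $\Gamma\cap\mathcal L\vdash\varphi$ if $\varphi\in\mathcal L$, and $\varphi\in\Gamma$ if $\varphi$ is a negated rule. **Arguments.** A *supporting element* is a proposition or a pair $(\mathcal S,\varphi\leadsto\psi)$ with $\mathcal S$ a finite set of supporting elements; a *support* is a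 finite set of supporting elements, and $\hat{\mathcal S}$ consists of the propositions $\varphi\in\mathcal S$ and the statements $\psi$ for $(\mathcal S',\varphi\leadsto\psi)\in\mathcal S$. *Arguments* $(\mathcal S,\psi)$ are defined inductively: (i) $(\{\psi\},\psi)$ for $\psi\in\Sigma$; (ii) $(\mathcal S_1\cup\dots\cup\mathcal S_k,\psi)$ if $(\mathcal S_i,\varphi_i)$, $1\le i\le k$, $k\ge 0$, are arguments and $\{\varphi_1,\dots,\varphi_k\}\vdash\psi$; (iii) $(\{(\mathcal S',\varphi\leadsto\psi)\},\psi)$ if $(\mathcal S',\varphi)$ is an argument and $\varphi\leadsto\psi\in\overline D$. An argument $(\mathcal S,\psi)$ is *minimal* if $\hat{\mathcal S}\vdash\psi$, no proper subset $\mathcal S'$ of $\mathcal S$ has $\hat{\mathcal S'}\vdash\psi$, and $(\mathcal S',\alpha)$ is a minimal argument for every $(\mathcal S',\alpha\leadsto\beta)\in\mathcal S$. **Tableaux.** Let $Q\subseteq\mathcal L$. An *argumentation tableau with tests $Q$* is a finite tree, each node of which is a set of pairs $(\mathcal U,\chi)$, where $\mathcal U$ is a finite set of supporting elements and *test marks*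 $\neg\varphi?$. It is obtained in finitely many steps from the one-node tree $\{(\{\sigma\},\sigma):\sigma\in\Sigma\}\cup\{(\{\neg\varphi?\},\neg\varphi):\varphi\in Q\}$ by the following steps. 1. Apply a rule to pairs in a leaf, whose one or two new children contain the leaf and in addition the pairs shown: $(\mathcal U,\varphi\wedge\psi)\Rightarrow(\mathcal U,\varphi),(\mathcal U,\psi)$; $(\mathcal U,\varphi\vee\psi)\Rightarrow(\mathcal U,\varphi)\mid(\mathcal U,\psi)$; $(\mathcal U,\varphi\to\psi)\Rightarrow(\mathcal U,\neg\varphi)\mid(\mathcal U,\psi)$; $(\mathcal U,\varphi\leftrightarrow\psi)\Rightarrow(\mathcal U,\varphi\to\psi),(\mathcal U,\psi\to\varphi)$; $(\mathcal U,\neg(\varphi\vee\psi))\Rightarrow(\mathcal U,\neg\varphi),(\mathcal U,\neg\psi)$; $(\mathcal U,\neg(\varphi\wedge\psi))\Rightarrow(\mathcal U,\neg\varphi)\mid(\mathcal U,\neg\psi)$; $(\mathcal U,\neg(\varphi\to\psi))\Rightarrow(\mathcal U,\varphi),(\mathcal U,\neg\psi)$; $(\mathcal U,\neg(\varphi\leftrightarrow\psi))\Rightarrow(\mathcal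 U,\neg(\varphi\to\psi))\mid(\mathcal U,\neg(\psi\to\varphi))$; $(\mathcal U,\neg\neg\varphi)\Rightarrow(\mathcal U,\varphi)$; $(\mathcal U,\varphi),(\mathcal U',\neg\varphi)\Rightarrow(\mathcal U\cup\mathcal U',\bot)$; and in predicate logic also $(\mathcal U,\forall x\,\varphi)\Rightarrow(\mathcal U,\varphi[x/t])$; $(\mathcal U,\neg\exists x\,\varphi)\Rightarrow(\mathcal U,\neg\varphi[x/t])$; $(\mathcal U,\exists x\,\varphi)\Rightarrow(\mathcal U,\varphi[x/c])$; $(\mathcal U,\neg\forall x\,\varphi)\Rightarrow(\mathcal U,\neg\varphi[x/c])$. Here $t$ is a closed term that occurs in the leaf or, if no closed term occurs there, a new constant; $c$ is a new constant that does not occur in the leaf. The new constants come from a fixed countably infinite set of constants outside the signature. 2. If the current tableau determines the support $\mathcal S$ for $\varphi$ (see below) and $\varphi\leadsto\psi\in\overline D$, add $(\{(\mathcal S,\varphi\leadsto\psi)\},\psi)$ to every node. A set $\mathcal U$ is a *support for the closure* of a tableau with leaves $\Lambda_1,\dots,\Lambda_n$ if $\mathcal U=\bigcup_i\mathcal U_i$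 with $(\mathcal U_i,\bot)\in\Lambda_i$ for each $i$. A tableau *determines* the support $\mathcal S$ for $\varphi\in\mathcal L$ if $(\{\neg\varphi?\},\neg\varphi)$ is in its root and it has a support $\mathcal U$ for its closure that contains no test mark other than possibly $\neg\varphi?$, with $\mathcal S=\mathcal U\setminus\{\neg\varphi?\}$. The pair $(\mathcal S,\psi)$ *can be derived with tests $Q$* if some tableau with tests $Q$ determines $\mathcal S$ for $\psi$ (when $\psi\in\mathcal L$), respectively contains $(\mathcal S,\psi)$ in its root (when $\psi$ is a negated rule). **Theorem.** In propositional logic and in predicate logic, for all $\Sigma$ and $D$: (a) every minimal argument $(\mathcal S,\psi)$ can be derived by an argumentation tableau whose tests are the antecedents of all rules in $\overline D$ together with $\psi$ (if $\psi\in\mathcal L$); (b) if $(\mathcal S,\psi)$ can be derived by an argumentation tableau, with any set $Q$ of tests, then it is an argument. -/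

import Mathlib

open scoped Classical

universe u v w

namespace ArgTab

/-! ### Defeasible rules over a set `F` of propositions -/

/-- What an argument may support: a proposition, or a negated defeasible rule `not (η ⇝ μ)`,
where `μ` may again be of either form. -/
inductive Stmt (F : Type w) : Type w
  | prop (φ : F) : Stmt F
  | notRule (η : F) (μ : Stmt F) : Stmt F

/-- A defeasible rule `ante ⇝ cons`. -/
structure Rule (F : Type w) : Type w where
  ante : F
  cons : Stmt F

def Stmt.map {F : Type u} {G : Type v} (f : F → G) : Stmt F → Stmt G
  | .prop φ => .prop (f φ)
  | .notRule η μ => .notRule (f η) (μ.map f)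

def Rule.map {F : Type u} {G : Type v} (f : F → G) (r : Rule F) : Rule G :=
  ⟨f r.ante, r.cons.map f⟩

/-- The propositions written in a statement. -/
def Stmt.forms {F : Type w} : Stmt F → Set F
  | .prop φ => {φ}
  | .notRule η μ => insert η μ.forms

/-! ### Supporting elements

A supporting element is either a proposition or a pair `(S, r)` of a finite set `S` of supporting
elements and a rule `r`.  The type `Elem F` of supporting elements is the least solution of
`X ≃ F ⊕ (Finset X × Rule F)`. -/

def ElemF (F : Type w) (X : Type w) : Type w := F ⊕ (Finset X × Rule F)

noncomputable instance (F : Type w) : Functor (ElemF F) where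
  map f := Sum.map id (Prod.map (Finset.image f) id)

noncomputable instance (F : Type w) : QPF (ElemF F) where
  P := ⟨F ⊕ (ℕ × Rule F), fun a => ULift (Fin (Sum.elim (fun _ => 0) (fun p => p.1) a))⟩
  abs := fun
    | ⟨.inl φ, _⟩ => .inl φ
    | ⟨.inr (_, r), f⟩ => .inr (Finset.univ.image (fun i => f ⟨i⟩), r)
  repr := fun
    | .inl φ => ⟨.inl φ, fun i => i.down.elim0⟩
    | .inr (S, r) => ⟨.inr (S.card, r), fun i => (S.equivFin.symm i.down : _)⟩
  abs_repr := by
    rintro α (φ | ⟨S, r⟩)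
    · rfl
    · have : (Finset.univ.image fun i : Fin S.card => ((S.equivFin.symm i : S) : α)) = S := by
        ext x
        simp only [Finset.mem_image, Finset.mem_univ, true_and]
        constructor
        · rintro ⟨i, rfl⟩
          exact (S.equivFin.symm i).2
        · intro hx
          exact ⟨S.equivFin ⟨x, hx⟩, by simp⟩
      exact congrArg (fun T => (Sum.inr (T, r) : ElemF F α)) this
  abs_map := by
    rintro α β f ⟨(φ | ⟨n, r⟩), g⟩
    · rfl
    · have : (Finset.univ.image fun i : Fin n => f (g ⟨i⟩)) =
          (Finset.univ.image fun i : Fin n => g ⟨i⟩).image f := by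
        rw [Finset.image_image]; rfl
      exact congrArg (fun T => (Sum.inr (T, r) : ElemF F β)) this

/-- Supporting elements. -/
def Elem (F : Type w) : Type w := QPF.Fix (ElemF F)

/-- The proposition `φ` as a supporting element. -/
noncomputable def Elem.prop {F : Type w} (φ : F) : Elem F :=
  QPF.Fix.mk (F := ElemF F) (Sum.inl φ)

/-- The supporting element `(S, r)`. -/
noncomputable def Elem.rule {F : Type w} (S : Finset (Elem F)) (r : Rule F) : Elem F :=
  QPF.Fix.mk (F := ElemF F) (Sum.inr (S, r))

noncomputable def Elem.dest {F : Type w} (e : Elem F) : F ⊕ (Finset (Elem F) × Rule F) :=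
  QPF.Fix.dest (F := ElemF F) e

theorem Elem.dest_prop {F : Type w} (φ : F) : (Elem.prop φ).dest = Sum.inl φ :=
  QPF.Fix.dest_mk (F := ElemF F) _

theorem Elem.dest_rule {F : Type w} (S : Finset (Elem F)) (r : Rule F) :
    (Elem.rule S r).dest = Sum.inr (S, r) :=
  QPF.Fix.dest_mk (F := ElemF F) _

theorem Elem.prop_inj {F : Type w} {φ ψ : F} (h : Elem.prop φ = Elem.prop ψ) : φ = ψ := by
  have := congrArg Elem.dest h
  simpa [Elem.dest_prop] using this

theorem Elem.rule_inj {F : Type w} {S T : Finset (Elem F)} {r s : Rule F}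
    (h : Elem.rule S r = Elem.rule T s) : S = T ∧ r = s := by
  have := congrArg Elem.dest h
  simpa [Elem.dest_rule] using this

theorem Elem.prop_ne_rule {F : Type w} (φ : F) (S : Finset (Elem F)) (r : Rule F) :
    Elem.prop φ ≠ Elem.rule S r := by
  intro h
  have := congrArg Elem.dest h
  simp [Elem.dest_rule, Elem.dest_prop] at this

/-- Structural induction on supporting elements. -/
theorem Elem.induction {F : Type w} {p : Elem F → Prop} (hprop : ∀ φ, p (Elem.prop φ))
    (hrule : ∀ S r, (∀ e ∈ S, p e) → p (Elem.rule S r)) (e : Elem F) : p e := by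
  refine QPF.Fix.ind (F := ElemF F) p ?_ e
  rintro (φ | ⟨S, r⟩) h
  · exact hprop φ
  · refine hrule S r ?_
    obtain ⟨y, hy⟩ := h
    rcases y with ψ | ⟨T, s⟩
    · cases hy
    · have hy' : (Sum.inr (T.image Subtype.val, s) : F ⊕ (Finset (Elem F) × Rule F)) =
        Sum.inr (S, r) := hy
      have h1 : T.image Subtype.val = S := by simpa using congrArg (fun z => z) (by
        have := Sum.inr.inj hy'
        exact congrArg Prod.fst this)
      intro e he
      rw [← h1] at he
      obtain ⟨a, -, rfl⟩ := Finset.mem_image.1 he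
      exact a.2

/-- The statement that a supporting element contributes: `φ` for a proposition `φ`, and `ψ` for
`(S, φ ⇝ ψ)`. -/
noncomputable def Elem.claim {F : Type w} (e : Elem F) : Stmt F :=
  match e.dest with
  | .inl φ => .prop φ
  | .inr (_, r) => r.cons

/-- The set `Ŝ` of supporting statements of a support `S`. -/
def hat {F : Type w} (S : Finset (Elem F)) : Set (Stmt F) := {χ | ∃ e ∈ S, e.claim = χ}

/-! ### Logics with a tableau calculus

`TableauLogic F N` only bundles the data used below, for propositions of type `F` and formulas of
type `N` occurring in tableaux (in predicate logic these may contain new constants).  It is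
instantiated by `propLogic` and `predLogic`. -/

structure TableauLogic (F N : Type w) where
  /-- `Γ ⊢ φ` -/
  Entails : Set F → F → Prop
  /-- the inclusion of the propositions in the formulas of tableaux -/
  emb : F → N
  neg : N → N
  bot : N
  /-- `Linear Γ φ l`: in a node with formulas `Γ`, the formula `φ` may be rewritten into the
  formulas `l`, which are all added to a single child. -/
  Linear : Set N → N → List N → Prop
  /-- `Branching φ a b`: the formula `φ` may be rewritten into `a` in one child and `b` in
  another one. -/
  Branching : N → N → N → Prop

section

variable {F N : Type w} (𝓛 : TableauLogic F N)

/-- `Γ ⊢ ψ` for statements.  Negated rules are not propositions of the logic: they take no part in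
its inferences, and follow only from themselves. -/
def TableauLogic.EntailsStmt (Γ : Set (Stmt F)) : Stmt F → Prop
  | .prop φ => 𝓛.Entails {χ | Stmt.prop χ ∈ Γ} φ
  | .notRule η μ => Stmt.notRule η μ ∈ Γ

/-! ### Arguments -/

/-- `IsArgument 𝓛 K D S ψ`: the pair `(S, ψ)` is an argument from the information `K` and the
(ground) rules `D`. -/
inductive IsArgument (K : Set F) (D : Set (Rule F)) : Finset (Elem F) → Stmt F → Prop
  | premise (ψ : F) : ψ ∈ K → IsArgument K D {Elem.prop ψ} (.prop ψ)
  | deduction (k : ℕ) (S : Fin k → Finset (Elem F)) (φ : Fin k → Stmt F) (ψ : Stmt F) :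
      (∀ i, IsArgument K D (S i) (φ i)) → 𝓛.EntailsStmt (Set.range φ) ψ →
      IsArgument K D (Finset.univ.biUnion S) ψ
  | defeasible (S : Finset (Elem F)) (r : Rule F) :
      IsArgument K D S (.prop r.ante) → r ∈ D → IsArgument K D {Elem.rule S r} r.cons

/-- `(S, ψ)` is a minimal argument. -/
inductive IsMinimalArgument (K : Set F) (D : Set (Rule F)) : Finset (Elem F) → Stmt F → Prop
  | mk (S : Finset (Elem F)) (ψ : Stmt F) :
      IsArgument 𝓛 K D S ψ →
      𝓛.EntailsStmt (hat S) ψ →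
      (∀ S' : Finset (Elem F), S' ⊂ S → ¬ 𝓛.EntailsStmt (hat S') ψ) →
      (∀ (S' : Finset (Elem F)) (r : Rule F), Elem.rule S' r ∈ S →
        IsMinimalArgument K D S' (.prop r.ante)) →
      IsMinimalArgument K D S ψ

end

/-! ### Tableaux -/

/-- Elements of the supports in a tableau: supporting elements, and `test φ` for `¬φ?`. -/
inductive Mark (F : Type w) : Type w
  | elem (e : Elem F) : Mark F
  | test (φ : F) : Mark F

/-- A supporting set, without tests, as a support in a tableau. -/
noncomputable def marks {F : Type w} (S : Finset (Elem F)) : Finset (Mark F) := S.image Mark.elem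

/-- The pairs `(S, φ)` in the nodes of a tableau. -/
abbrev Entry (F N : Type w) : Type w := Finset (Mark F) × Stmt N

/-- Trees whose nodes are labelled by sets of pairs `(S, φ)`; a node has at most two children. -/
inductive Tree (F N : Type w) : Type w
  | leaf (Γ : Set (Entry F N)) : Tree F N
  | one (Γ : Set (Entry F N)) (T : Tree F N) : Tree F N
  | two (Γ : Set (Entry F N)) (T₁ T₂ : Tree F N) : Tree F N

namespace Tree

variable {F N : Type w}

def root : Tree F N → Set (Entry F N)
  | leaf Γ => Γ
  | one Γ _ => Γ
  | two Γ _ _ => Γ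

/-- Extend every node with the pair `e`. -/
def extend (e : Entry F N) : Tree F N → Tree F N
  | leaf Γ => leaf (insert e Γ)
  | one Γ T => one (insert e Γ) (T.extend e)
  | two Γ T₁ T₂ => two (insert e Γ) (T₁.extend e) (T₂.extend e)

/-- `T.IsClosureSupport 𝓛 S`: the tree is closed and `S` is the union of sets `Sᵢ`, one for each
leaf `Λᵢ`, such that `(Sᵢ, ⊥) ∈ Λᵢ`. -/
def IsClosureSupport (𝓛 : TableauLogic F N) : Tree F N → Finset (Mark F) → Prop
  | leaf Γ, S => (S, Stmt.prop 𝓛.bot) ∈ Γ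
  | one _ T, S => T.IsClosureSupport 𝓛 S
  | two _ T₁ T₂, S => ∃ S₁ S₂, T₁.IsClosureSupport 𝓛 S₁ ∧ T₂.IsClosureSupport 𝓛 S₂ ∧ S = S₁ ∪ S₂

end Tree

section

variable {F N : Type w} (𝓛 : TableauLogic F N)

/-- The formulas written in the statements of a node. -/
def nodeForms (Γ : Set (Entry F N)) : Set N := {χ | ∃ e ∈ Γ, χ ∈ e.2.forms}

/-- The pairs `(S, χ)` for the formulas `χ` in `l`. -/
def entries (S : Finset (Mark F)) (l : List N) : Set (Entry F N) :=
  {e | ∃ χ ∈ l, e = (S, Stmt.prop χ)}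

/-- One application of a tableau rule at a leaf.  Children inherit all pairs of their parent. -/
inductive Step : Tree F N → Tree F N → Prop
  | linear (Γ : Set (Entry F N)) (S : Finset (Mark F)) (φ : N) (l : List N) :
      (S, Stmt.prop φ) ∈ Γ → 𝓛.Linear (nodeForms Γ) φ l →
      Step (.leaf Γ) (.one Γ (.leaf (Γ ∪ entries S l)))
  | branching (Γ : Set (Entry F N)) (S : Finset (Mark F)) (φ a b : N) :
      (S, Stmt.prop φ) ∈ Γ → 𝓛.Branching φ a b →
      Step (.leaf Γ) (.two Γ (.leaf (Γ ∪ entries S [a])) (.leaf (Γ ∪ entries S [b])))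
  | close (Γ : Set (Entry F N)) (S S' : Finset (Mark F)) (φ : N) :
      (S, Stmt.prop φ) ∈ Γ → (S', Stmt.prop (𝓛.neg φ)) ∈ Γ →
      Step (.leaf Γ) (.one Γ (.leaf (Γ ∪ entries (S ∪ S') [𝓛.bot])))
  | inOne (Γ : Set (Entry F N)) (T T' : Tree F N) :
      Step T T' → Step (.one Γ T) (.one Γ T')
  | inLeft (Γ : Set (Entry F N)) (T₁ T₁' T₂ : Tree F N) :
      Step T₁ T₁' → Step (.two Γ T₁ T₂) (.two Γ T₁' T₂)
  | inRight (Γ : Set (Entry F N)) (T₁ T₂ T₂' : Tree F N) :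
      Step T₂ T₂' → Step (.two Γ T₁ T₂) (.two Γ T₁ T₂')

/-- The test `({¬φ?}, ¬φ)`. -/
def testEntry (φ : F) : Entry F N := ({Mark.test φ}, Stmt.prop (𝓛.neg (𝓛.emb φ)))

/-- The initial root: `({σ}, σ)` for the information `K`, and the tests for the set `Q`. -/
def initialRoot (K Q : Set F) : Set (Entry F N) :=
  {e | ∃ σ ∈ K, e = ({Mark.elem (Elem.prop σ)}, Stmt.prop (𝓛.emb σ))} ∪
    {e | ∃ φ ∈ Q, e = testEntry 𝓛 φ}

/-- The tableau `T` determines the support `S` for the proposition `φ`: the root contains the test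
for `φ`, and `S` is what remains of a support for the closure of `T`, containing no other test,
when `¬φ?` is removed from it (if it is there at all). -/
def Determines (T : Tree F N) (S : Finset (Elem F)) (φ : F) : Prop :=
  testEntry 𝓛 φ ∈ T.root ∧
    (T.IsClosureSupport 𝓛 (insert (Mark.test φ) (marks S)) ∨ T.IsClosureSupport 𝓛 (marks S))

/-- Argumentation tableaux for the information `K`, the (ground) rules `D` and the tests `Q`. -/
inductive IsTableau (K : Set F) (D : Set (Rule F)) (Q : Set F) : Tree F N → Prop
  | start : IsTableau K D Q (.leaf (initialRoot 𝓛 K Q))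
  | step (T T' : Tree F N) : IsTableau K D Q T → Step 𝓛 T T' → IsTableau K D Q T'
  | extend (T : Tree F N) (S : Finset (Elem F)) (r : Rule F) :
      IsTableau K D Q T → r ∈ D → Determines 𝓛 T S r.ante →
      IsTableau K D Q (T.extend (marks {Elem.rule S r}, r.cons.map 𝓛.emb))

/-- The argument `(S, ψ)` can be derived by an argumentation tableau with tests `Q`: for a
proposition `ψ`, the support is determined by the closure of a tableau; for a negated rule, for
which there is no test, the argument has been added to the root. -/
def Derivable (K : Set F) (D : Set (Rule F)) (Q : Set F) (S : Finset (Elem F)) :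
    Stmt F → Prop
  | .prop φ => ∃ T, IsTableau 𝓛 K D Q T ∧ Determines 𝓛 T S φ
  | .notRule η μ => ∃ T, IsTableau 𝓛 K D Q T ∧
      (marks S, (Stmt.notRule η μ).map 𝓛.emb) ∈ T.root

end

/-- The tests for an argument with conclusion `ψ`: the antecedents of all rules, and `ψ` itself
if it is a proposition. -/
def testsFor {F : Type w} (D : Set (Rule F)) (ψ : Stmt F) : Set F :=
  {φ | (∃ r ∈ D, r.ante = φ) ∨ ψ = Stmt.prop φ}

/-! ### Propositional logic -/

/-- Propositions over the atoms `P`. -/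
inductive PropForm (P : Type u) : Type u
  | bot : PropForm P
  | atom (p : P) : PropForm P
  | neg (a : PropForm P) : PropForm P
  | and (a b : PropForm P) : PropForm P
  | or (a b : PropForm P) : PropForm P
  | imp (a b : PropForm P) : PropForm P
  | iff (a b : PropForm P) : PropForm P

namespace PropForm

variable {P : Type u}

/-- `⊤`, as `¬⊥`. -/
def top : PropForm P := neg bot

def Sat (V : P → Prop) : PropForm P → Prop
  | bot => False
  | atom p => V p
  | neg a => ¬ a.Sat V
  | and a b => a.Sat V ∧ b.Sat V
  | or a b => a.Sat V ∨ b.Sat V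
  | imp a b => a.Sat V → b.Sat V
  | iff a b => (a.Sat V ↔ b.Sat V)

/-- Classical consequence. -/
def Entails (Γ : Set (PropForm P)) (φ : PropForm P) : Prop :=
  ∀ V : P → Prop, (∀ γ ∈ Γ, γ.Sat V) → φ.Sat V

inductive Linear : PropForm P → List (PropForm P) → Prop
  | and (a b : PropForm P) : Linear (and a b) [a, b]
  | iff (a b : PropForm P) : Linear (iff a b) [imp a b, imp b a]
  | neg_or (a b : PropForm P) : Linear (neg (or a b)) [neg a, neg b]
  | neg_imp (a b : PropForm P) : Linear (neg (imp a b)) [a, neg b]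
  | neg_neg (a : PropForm P) : Linear (neg (neg a)) [a]

inductive Branching : PropForm P → PropForm P → PropForm P → Prop
  | or (a b : PropForm P) : Branching (or a b) a b
  | imp (a b : PropForm P) : Branching (imp a b) (neg a) b
  | neg_and (a b : PropForm P) : Branching (neg (and a b)) (neg a) (neg b)
  | neg_iff (a b : PropForm P) :
      Branching (neg (iff a b)) (neg (imp a b)) (neg (imp b a))

end PropForm

/-- Propositional logic over the atoms `P`. -/
def propLogic (P : Type u) : TableauLogic (PropForm P) (PropForm P) where
  Entails := PropForm.Entails
  emb := id
  neg := PropForm.neg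
  bot := PropForm.bot
  Linear := fun _ => PropForm.Linear
  Branching := PropForm.Branching

/-! ### Predicate logic (without equality) -/

/-- Formulas over the symbols of `L` with free variables (or new constants) in `α` and `n` further
variables `0, …, n - 1`; a quantifier binds the last variable of its body. -/
inductive PredForm (L : FirstOrder.Language.{u, v}) (α : Type) : ℕ → Type (max u v)
  | bot {n : ℕ} : PredForm L α n
  | rel {n k : ℕ} (R : L.Relations k) (ts : Fin k → L.Term (α ⊕ Fin n)) : PredForm L α n
  | neg {n : ℕ} (a : PredForm L α n) : PredForm L α n
  | and {n : ℕ} (a b : PredForm L α n) : PredForm L α n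
  | or {n : ℕ} (a b : PredForm L α n) : PredForm L α n
  | imp {n : ℕ} (a b : PredForm L α n) : PredForm L α n
  | iff {n : ℕ} (a b : PredForm L α n) : PredForm L α n
  | all {n : ℕ} (a : PredForm L α (n + 1)) : PredForm L α n
  | ex {n : ℕ} (a : PredForm L α (n + 1)) : PredForm L α n

/-- `s` occurs in the term `t`, i.e. it is a subterm of `t`. -/
def TermOccurs {L : FirstOrder.Language.{u, v}} {β : Type} (s : L.Term β) : L.Term β → Prop
  | .var b => s = .var b
  | .func f ts => s = .func f ts ∨ ∃ i, TermOccurs s (ts i)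

namespace PredForm

variable {L : FirstOrder.Language.{u, v}} {α β : Type}

/-- `⊤`, as `¬⊥`. -/
def top {n : ℕ} : PredForm L α n := neg bot

def Sat {M : Type w} [L.Structure M] (x : α → M) :
    {n : ℕ} → PredForm L α n → (Fin n → M) → Prop
  | _, bot, _ => False
  | _, rel R ts, y => FirstOrder.Language.Structure.RelMap R
      fun i => (ts i).realize (Sum.elim x y)
  | _, neg a, y => ¬ a.Sat x y
  | _, and a b, y => a.Sat x y ∧ b.Sat x y
  | _, or a b, y => a.Sat x y ∨ b.Sat x y
  | _, imp a b, y => a.Sat x y → b.Sat x y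
  | _, iff a b, y => (a.Sat x y ↔ b.Sat x y)
  | _, all a, y => ∀ m : M, a.Sat x (Fin.snoc y m)
  | _, ex a, y => ∃ m : M, a.Sat x (Fin.snoc y m)

/-- A substitution under a quantifier: the bound variable is left alone. -/
def liftSubst {n m : ℕ} (f : α ⊕ Fin n → L.Term (β ⊕ Fin m)) :
    α ⊕ Fin (n + 1) → L.Term (β ⊕ Fin (m + 1)) :=
  Sum.elim (fun a => (f (.inl a)).relabel (Sum.map id Fin.castSucc))
    (Fin.lastCases (.var (.inr (Fin.last m)))
      fun i => (f (.inr i)).relabel (Sum.map id Fin.castSucc))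

/-- Simultaneous (capture-avoiding) substitution. -/
def subst : {n : ℕ} → PredForm L α n → {m : ℕ} → (α ⊕ Fin n → L.Term (β ⊕ Fin m)) →
    PredForm L β m
  | _, bot, _, _ => bot
  | _, rel R ts, _, f => rel R fun i => (ts i).subst f
  | _, neg a, _, f => neg (a.subst f)
  | _, and a b, _, f => and (a.subst f) (b.subst f)
  | _, or a b, _, f => or (a.subst f) (b.subst f)
  | _, imp a b, _, f => imp (a.subst f) (b.subst f)
  | _, iff a b, _, f => iff (a.subst f) (b.subst f)
  | _, all a, _, f => all (a.subst (liftSubst f))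
  | _, ex a, _, f => ex (a.subst (liftSubst f))

/-- Replace the elements of `α` by closed terms over `β`. -/
def substFree (φ : PredForm L α 0) (t : α → L.Term β) : PredForm L β 0 :=
  φ.subst (Sum.elim (fun a => (t a).relabel Sum.inl) (fun i => i.elim0))

/-- `φ[x/t]`, where `x` is the variable bound by a quantifier in front of `φ`. -/
def inst (φ : PredForm L α 1) (t : L.Term α) : PredForm L α 0 :=
  φ.subst (Sum.elim (fun a => .var (.inl a)) (fun _ => t.relabel Sum.inl))

/-- The closed term `t` occurs in a formula. -/
def Occurs (t : L.Term α) : {n : ℕ} → PredForm L α n → Prop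
  | _, bot => False
  | _, rel _ ts => ∃ i, TermOccurs (t.relabel Sum.inl) (ts i)
  | _, neg a => a.Occurs t
  | _, and a b => a.Occurs t ∨ b.Occurs t
  | _, or a b => a.Occurs t ∨ b.Occurs t
  | _, imp a b => a.Occurs t ∨ b.Occurs t
  | _, iff a b => a.Occurs t ∨ b.Occurs t
  | _, all a => a.Occurs t
  | _, ex a => a.Occurs t

/-- Classical consequence between sentences. -/
def Entails (Γ : Set (PredForm L Empty 0)) (φ : PredForm L Empty 0) : Prop :=
  ∀ (M : Type (max u v)) [L.Structure M] [Nonempty M],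
    (∀ γ ∈ Γ, γ.Sat (M := M) Empty.elim Fin.elim0) → φ.Sat (M := M) Empty.elim Fin.elim0

/-- The new constant `c` does not occur in `Γ`. -/
def Fresh (Γ : Set (PredForm L ℕ 0)) (c : ℕ) : Prop :=
  ∀ χ ∈ Γ, ¬ χ.Occurs (.var c)

/-- The terms that may be substituted for universal variables: those that occur in `Γ`, and, only
if no closed term occurs in `Γ`, the new constants. -/
def Admissible (Γ : Set (PredForm L ℕ 0)) (t : L.Term ℕ) : Prop :=
  (∃ χ ∈ Γ, χ.Occurs t) ∨
    ((∀ χ ∈ Γ, ∀ s : L.Term ℕ, ¬ χ.Occurs s) ∧ ∃ c : ℕ, t = .var c)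

/-- The new constants are the elements of `ℕ`. -/
inductive Linear (Γ : Set (PredForm L ℕ 0)) : PredForm L ℕ 0 → List (PredForm L ℕ 0) → Prop
  | and (a b : PredForm L ℕ 0) : Linear Γ (and a b) [a, b]
  | iff (a b : PredForm L ℕ 0) : Linear Γ (iff a b) [imp a b, imp b a]
  | neg_or (a b : PredForm L ℕ 0) : Linear Γ (neg (or a b)) [neg a, neg b]
  | neg_imp (a b : PredForm L ℕ 0) : Linear Γ (neg (imp a b)) [a, neg b]
  | neg_neg (a : PredForm L ℕ 0) : Linear Γ (neg (neg a)) [a]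
  | all (a : PredForm L ℕ 1) (t : L.Term ℕ) : Admissible Γ t → Linear Γ (all a) [a.inst t]
  | ex (a : PredForm L ℕ 1) (c : ℕ) : Fresh Γ c → Linear Γ (ex a) [a.inst (.var c)]
  | neg_all (a : PredForm L ℕ 1) (c : ℕ) :
      Fresh Γ c → Linear Γ (neg (all a)) [neg (a.inst (.var c))]
  | neg_ex (a : PredForm L ℕ 1) (t : L.Term ℕ) :
      Admissible Γ t → Linear Γ (neg (ex a)) [neg (a.inst t)]

inductive Branching : PredForm L ℕ 0 → PredForm L ℕ 0 → PredForm L ℕ 0 → Prop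
  | or (a b : PredForm L ℕ 0) : Branching (or a b) a b
  | imp (a b : PredForm L ℕ 0) : Branching (imp a b) (neg a) b
  | neg_and (a b : PredForm L ℕ 0) : Branching (neg (and a b)) (neg a) (neg b)
  | neg_iff (a b : PredForm L ℕ 0) :
      Branching (neg (iff a b)) (neg (imp a b)) (neg (imp b a))

end PredForm

/-- Predicate logic over the symbols of `L`.  Its propositions are the sentences over `L`; the
formulas in tableaux may also contain the new constants `0, 1, 2, …`. -/
def predLogic (L : FirstOrder.Language.{u, v}) :
    TableauLogic (PredForm L Empty 0) (PredForm L ℕ 0) where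
  Entails := PredForm.Entails
  emb := fun φ => φ.substFree Empty.elim
  neg := PredForm.neg
  bot := PredForm.bot
  Linear := PredForm.Linear
  Branching := PredForm.Branching

/-- A defeasible rule with `n` free variables. -/
abbrev OpenRule (L : FirstOrder.Language.{u, v}) (n : ℕ) : Type (max u v) :=
  Rule (PredForm L (Fin n) 0)

/-- The ground instances of a set of rules with free variables. -/
def groundInstances {L : FirstOrder.Language.{u, v}} (D : Set (Σ n, OpenRule L n)) :
    Set (Rule (PredForm L Empty 0)) :=
  {r | ∃ d ∈ D, ∃ t : Fin d.1 → L.Term Empty, r = d.2.map fun φ => φ.substFree t}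

end ArgTab

/-!
Both directions rest on one fact about a tableau: reading a test mark `¬φ?` as the falsity of `φ`, and a
supporting element as the truth of its claim, the support for a closure is unsatisfiable.

Soundness.  An interpretation that satisfies all marks in a set `A` makes true, in some
leaf and under some assignment to the new constants, every proposition with support in `A`
(`Semantics.anyLeaf_faithful`).  Hence the supporting statements of a determined support entail the
tested proposition.  By induction on the tableau, the supporting elements in it come from premises,
or from rules whose antecedent has an argument, so that the determined support is that of an
argument.  A negated rule enters a root only by a rule of which it is the consequent; since the
propositions embed injectively into the formulas of tableaux, it is recovered from the root.

Completeness.  Following the nesting of a minimal argument, a tableau is extended until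
its root contains all members of the support.  Then every leaf can be closed with a support among
these members and the test: otherwise, the finitely many formulas in question form an open set
(`IsOpenSet`), which grows in countably many finite rounds (`exists_saturated_sequence`) to a
saturated set, and saturated sets have models.  By soundness, the members that are used entail the
conclusion, and by minimality these are all members (`exists_determines`).

In predicate logic, fresh constants exist because only finitely many new constants occur in a node.
The signature need not be countable: only terms that occur in a saturated set matter for its
term model, whose domain consists of these terms.  If no term occurs, the model has one element, and
a single instance of a universal formula, with whatever term the rules admit, is enough.
-/

universe x y

namespace ArgTab

/-! ### Statements and supporting elements -/

theorem Stmt.map_injective {F : Type u} {G : Type v} {f : F → G} (hf : Function.Injective f) :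
    Function.Injective (Stmt.map f) := by
  intro s
  induction s with
  | prop φ =>
    rintro (ψ | ⟨η, μ⟩) h
    · exact congrArg Stmt.prop (hf (Stmt.prop.inj h))
    · cases h
  | notRule η μ ih =>
    rintro (ψ | ⟨η', μ'⟩) h
    · cases h
    · obtain ⟨h₁, h₂⟩ := Stmt.notRule.inj h
      rw [hf h₁, ih h₂]

theorem Stmt.forms_map {F : Type w} {G : Type w} (f : F → G) (s : Stmt F) :
    (s.map f).forms = f '' s.forms := by
  induction s with
  | prop φ => simp [Stmt.map, Stmt.forms]
  | notRule η μ ih => simp [Stmt.map, Stmt.forms, ih, Set.image_insert_eq]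

@[simp]
theorem Elem.claim_prop {F : Type w} (φ : F) : (Elem.prop φ).claim = .prop φ := by
  simp [Elem.claim, Elem.dest_prop]

@[simp]
theorem Elem.claim_rule {F : Type w} (S : Finset (Elem F)) (r : Rule F) :
    (Elem.rule S r).claim = r.cons := by
  simp [Elem.claim, Elem.dest_rule]

theorem marks_injective {F : Type w} : Function.Injective (marks (F := F)) :=
  Finset.image_injective fun _ _ h => Mark.elem.inj h

theorem elem_mem_marks {F : Type w} {S : Finset (Elem F)} {e : Elem F} :
    Mark.elem e ∈ marks S ↔ e ∈ S := by
  simp [marks]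

section

variable {F N : Type w} {𝓛 : TableauLogic F N} {K Q : Set F} {D : Set (Rule F)}

/-! ### Arguments and their supports -/

/-- A supporting element that may occur in the support of an argument. -/
def IsValidElem (𝓛 : TableauLogic F N) (K : Set F) (D : Set (Rule F)) (e : Elem F) : Prop :=
  (∃ σ ∈ K, e = .prop σ) ∨
    ∃ S, ∃ r ∈ D, IsArgument 𝓛 K D S (.prop r.ante) ∧ e = .rule S r

theorem IsArgument.isValidElem {S : Finset (Elem F)} {ψ : Stmt F} (h : IsArgument 𝓛 K D S ψ) :
    ∀ e ∈ S, IsValidElem 𝓛 K D e := by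
  induction h with
  | premise ψ hψ =>
    intro e he
    exact .inl ⟨ψ, hψ, Finset.mem_singleton.1 he⟩
  | deduction k S φ ψ _ _ ih =>
    intro e he
    obtain ⟨i, -, hi⟩ := Finset.mem_biUnion.1 he
    exact ih i e hi
  | defeasible S r h hr _ =>
    intro e he
    exact .inr ⟨S, r, hr, h, Finset.mem_singleton.1 he⟩

theorem IsValidElem.isArgument {e : Elem F} (h : IsValidElem 𝓛 K D e) :
    IsArgument 𝓛 K D {e} e.claim := by
  obtain ⟨σ, hσ, rfl⟩ | ⟨S, r, hr, h, rfl⟩ := h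
  · rw [Elem.claim_prop]
    exact .premise σ hσ
  · rw [Elem.claim_rule]
    exact .defeasible S r h hr

/-- A single application of deduction to the one-element arguments for the members of `S`. -/
theorem IsArgument.of_entailsStmt_hat {S : Finset (Elem F)} {ψ : Stmt F}
    (hS : ∀ e ∈ S, IsValidElem 𝓛 K D e) (h : 𝓛.EntailsStmt (hat S) ψ) :
    IsArgument 𝓛 K D S ψ := by
  let s : Fin S.card → Elem F := fun i => S.equivFin.symm i
  have hs : ∀ i, s i ∈ S := fun i => (S.equivFin.symm i).2
  have hs' : ∀ e ∈ S, ∃ i, s i = e := fun e he => ⟨S.equivFin ⟨e, he⟩, by simp [s]⟩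
  have h₁ : Finset.univ.biUnion (fun i => ({s i} : Finset (Elem F))) = S := by
    ext e
    simp only [Finset.mem_biUnion, Finset.mem_univ, true_and, Finset.mem_singleton]
    exact ⟨fun ⟨i, hi⟩ => hi ▸ hs i, fun he => (hs' e he).imp fun i hi => hi.symm⟩
  have h₂ : Set.range (fun i => (s i).claim) = hat S := by
    ext χ
    constructor
    · rintro ⟨i, rfl⟩
      exact ⟨_, hs i, rfl⟩
    · rintro ⟨e, he, rfl⟩
      obtain ⟨i, rfl⟩ := hs' e he
      exact ⟨i, rfl⟩
  have := IsArgument.deduction (𝓛 := 𝓛) (K := K) (D := D) S.card (fun i => {s i})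
    (fun i => (s i).claim) ψ (fun i => (hS _ (hs i)).isArgument) (by rwa [h₂])
  rwa [h₁] at this

/-! ### Leaves of tableaux -/

/-- Some leaf of the tree has the property `p`. -/
def Tree.AnyLeaf (p : Set (Entry F N) → Prop) : Tree F N → Prop
  | .leaf Γ => p Γ
  | .one _ T => T.AnyLeaf p
  | .two _ T₁ T₂ => T₁.AnyLeaf p ∨ T₂.AnyLeaf p

/-- All leaves of the tree have the property `p`. -/
def Tree.AllLeaves (p : Set (Entry F N) → Prop) : Tree F N → Prop
  | .leaf Γ => p Γ
  | .one _ T => T.AllLeaves p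
  | .two _ T₁ T₂ => T₁.AllLeaves p ∧ T₂.AllLeaves p

theorem Tree.AnyLeaf.extend {p : Set (Entry F N) → Prop} {e : Entry F N}
    (hp : ∀ Γ, p Γ → p (insert e Γ)) {T : Tree F N} (h : T.AnyLeaf p) :
    (T.extend e).AnyLeaf p := by
  induction T with
  | leaf Γ => exact hp Γ h
  | one Γ T ih => exact ih h
  | two Γ T₁ T₂ ih₁ ih₂ => exact h.imp ih₁ ih₂

theorem Tree.AllLeaves.extend {p q : Set (Entry F N) → Prop} {e : Entry F N}
    (hp : ∀ Γ, p Γ → q (insert e Γ)) {T : Tree F N} (h : T.AllLeaves p) :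
    (T.extend e).AllLeaves q := by
  induction T with
  | leaf Γ => exact hp Γ h
  | one Γ T ih => exact ih h
  | two Γ T₁ T₂ ih₁ ih₂ => exact ⟨ih₁ h.1, ih₂ h.2⟩

theorem Tree.AllLeaves.mono {p q : Set (Entry F N) → Prop} (hp : ∀ Γ, p Γ → q Γ)
    {T : Tree F N} (h : T.AllLeaves p) : T.AllLeaves q := by
  induction T with
  | leaf Γ => exact hp Γ h
  | one Γ T ih => exact ih h
  | two Γ T₁ T₂ ih₁ ih₂ => exact ⟨ih₁ h.1, ih₂ h.2⟩

theorem Tree.AllLeaves.and {p q : Set (Entry F N) → Prop} {T : Tree F N} (hp : T.AllLeaves p)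
    (hq : T.AllLeaves q) : T.AllLeaves fun Γ => p Γ ∧ q Γ := by
  induction T with
  | leaf Γ => exact ⟨hp, hq⟩
  | one Γ T ih => exact ih hp hq
  | two Γ T₁ T₂ ih₁ ih₂ => exact ⟨ih₁ hp.1 hq.1, ih₂ hp.2 hq.2⟩

theorem Tree.root_extend (e : Entry F N) (T : Tree F N) :
    (T.extend e).root = insert e T.root := by
  cases T <;> rfl

/-- A property of leaves that passes from a leaf to the leaves created by tableau rules. -/
structure IsInherited (𝓛 : TableauLogic F N) (p : Set (Entry F N) → Prop) : Prop where
  linear : ∀ (Γ : Set (Entry F N)) (S : Finset (Mark F)) (φ : N) (l : List N), p Γ →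
    (S, Stmt.prop φ) ∈ Γ → 𝓛.Linear (nodeForms Γ) φ l → p (Γ ∪ entries S l)
  branching : ∀ (Γ : Set (Entry F N)) (S : Finset (Mark F)) (φ a b : N), p Γ →
    (S, Stmt.prop φ) ∈ Γ → 𝓛.Branching φ a b → p (Γ ∪ entries S [a]) ∧ p (Γ ∪ entries S [b])
  close : ∀ (Γ : Set (Entry F N)) (S S' : Finset (Mark F)) (φ : N), p Γ →
    (S, Stmt.prop φ) ∈ Γ → (S', Stmt.prop (𝓛.neg φ)) ∈ Γ → p (Γ ∪ entries (S ∪ S') [𝓛.bot])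

theorem Step.allLeaves {p : Set (Entry F N) → Prop} (hp : IsInherited 𝓛 p) {T T' : Tree F N}
    (hT : Step 𝓛 T T') (h : T.AllLeaves p) : T'.AllLeaves p := by
  induction hT with
  | linear Γ S φ l h₁ h₂ => exact hp.linear Γ S φ l h h₁ h₂
  | branching Γ S φ a b h₁ h₂ => exact hp.branching Γ S φ a b h h₁ h₂
  | close Γ S S' φ h₁ h₂ => exact hp.close Γ S S' φ h h₁ h₂
  | inOne Γ T T' _ ih => exact ih h
  | inLeft Γ T₁ T₁' T₂ _ ih => exact ⟨ih h.1, h.2⟩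
  | inRight Γ T₁ T₂ T₂' _ ih => exact ⟨h.1, ih h.2⟩

theorem Step.root_eq {T T' : Tree F N} (h : Step 𝓛 T T') : T'.root = T.root := by
  cases h <;> rfl

theorem IsInherited.of_superset {p : Set (Entry F N) → Prop}
    (hp : ∀ Γ Γ', Γ ⊆ Γ' → p Γ → p Γ') : IsInherited 𝓛 p where
  linear _ _ _ _ h _ _ := hp _ _ Set.subset_union_left h
  branching _ _ _ _ _ h _ _ :=
    ⟨hp _ _ Set.subset_union_left h, hp _ _ Set.subset_union_left h⟩
  close _ _ _ _ h _ _ := hp _ _ Set.subset_union_left h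

theorem IsTableau.root_subset {T : Tree F N} (h : IsTableau 𝓛 K D Q T) :
    T.AllLeaves (T.root ⊆ ·) := by
  induction h with
  | start => exact subset_rfl
  | step T T' _ hs ih =>
    rw [hs.root_eq]
    exact hs.allLeaves (.of_superset fun Γ Γ' h h' => h'.trans h) ih
  | extend T S r _ _ _ ih =>
    rw [Tree.root_extend]
    exact ih.extend fun Γ h => Set.insert_subset_insert h

theorem IsTableau.initialRoot_subset {T : Tree F N} (h : IsTableau 𝓛 K D Q T) :
    initialRoot 𝓛 K Q ⊆ T.root := by
  induction h with
  | start => exact subset_rfl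
  | step T T' _ hs ih => rwa [hs.root_eq]
  | extend T S r _ _ _ ih =>
    rw [Tree.root_extend]
    exact ih.trans (Set.subset_insert _ _)

theorem IsTableau.steps {T T' : Tree F N} (h : IsTableau 𝓛 K D Q T)
    (hs : Relation.ReflTransGen (Step 𝓛) T T') : IsTableau 𝓛 K D Q T' := by
  induction hs with
  | refl => exact h
  | tail _ h' ih => exact .step _ _ ih h'

theorem Steps.root_eq {T T' : Tree F N} (hs : Relation.ReflTransGen (Step 𝓛) T T') :
    T'.root = T.root := by
  induction hs with
  | refl => rfl
  | tail _ h' ih => rw [h'.root_eq, ih]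

theorem nodeForms_union_entries (Γ : Set (Entry F N)) (S : Finset (Mark F)) (l : List N) :
    nodeForms (Γ ∪ entries S l) ⊆ nodeForms Γ ∪ {χ | χ ∈ l} := by
  rintro χ ⟨e, he | ⟨χ', h', rfl⟩, hχ⟩
  · exact .inl ⟨e, he, hχ⟩
  · obtain rfl : χ = χ' := hχ
    exact .inr h'

theorem mem_nodeForms_of_prop {Γ : Set (Entry F N)} {S : Finset (Mark F)} {φ : N}
    (h : (S, Stmt.prop φ) ∈ Γ) : φ ∈ nodeForms Γ :=
  ⟨_, h, rfl⟩

/-! ### Soundness -/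

set_option linter.checkUnivs false in
/-- A semantics for which the consequence relation of a tableau logic is semantic consequence and
the tableau rules are sound.  The formulas of tableaux are evaluated under an assignment to the new
constants; a rule introducing a new constant may change the assignment, as long as the formulas of
the node stay true. -/
structure Semantics (𝓛 : TableauLogic F N) where
  Interp : Type x
  Assign : Interp → Type y
  sat : Interp → F → Prop
  satN : (i : Interp) → Assign i → N → Prop
  nonempty_assign : ∀ i, Nonempty (Assign i)
  entails_iff : ∀ Γ φ, 𝓛.Entails Γ φ ↔ ∀ i, (∀ γ ∈ Γ, sat i γ) → sat i φ
  satN_emb : ∀ i v φ, satN i v (𝓛.emb φ) ↔ sat i φ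
  satN_neg : ∀ i v φ, satN i v (𝓛.neg φ) ↔ ¬ satN i v φ
  not_satN_bot : ∀ i v, ¬ satN i v 𝓛.bot
  linear : ∀ i v Γ φ l, φ ∈ Γ → 𝓛.Linear Γ φ l → satN i v φ →
    ∃ v', (∀ χ ∈ Γ, satN i v χ → satN i v' χ) ∧ ∀ χ ∈ l, satN i v' χ
  branching : ∀ i v φ a b, 𝓛.Branching φ a b → satN i v φ → satN i v a ∨ satN i v b

namespace Semantics

variable (M : Semantics.{w, x, y} 𝓛)

/-- An interpretation satisfies a mark if the claim of its supporting element is true, provided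
it is a proposition, or the tested proposition is false. -/
def MarkHolds (i : M.Interp) : Mark F → Prop
  | .elem e => ∀ φ, e.claim = .prop φ → M.sat i φ
  | .test φ => ¬ M.sat i φ

/-- Under some assignment, all propositions of the node with support in `A` are true. -/
def Faithful (i : M.Interp) (A : Set (Mark F)) (Γ : Set (Entry F N)) : Prop :=
  ∃ v, ∀ U χ, (U, Stmt.prop χ) ∈ Γ → ↑U ⊆ A → M.satN i v χ

theorem faithful_union {i : M.Interp} {A : Set (Mark F)} {Γ : Set (Entry F N)}
    {S : Finset (Mark F)} {l : List N} (v v' : M.Assign i)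
    (hv : ∀ U χ, (U, Stmt.prop χ) ∈ Γ → ↑U ⊆ A → M.satN i v χ)
    (h₁ : ∀ χ ∈ nodeForms Γ, M.satN i v χ → M.satN i v' χ)
    (h₂ : ↑S ⊆ A → ∀ χ ∈ l, M.satN i v' χ) : M.Faithful i A (Γ ∪ entries S l) := by
  refine ⟨v', ?_⟩
  rintro U χ (h | ⟨χ', hχ', h⟩) hU
  · exact h₁ χ (mem_nodeForms_of_prop h) (hv U χ h hU)
  · cases h
    exact h₂ hU χ hχ'

theorem anyLeaf_faithful_step {i : M.Interp} {A : Set (Mark F)} {T T' : Tree F N}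
    (hT : Step 𝓛 T T') (h : T.AnyLeaf (M.Faithful i A)) : T'.AnyLeaf (M.Faithful i A) := by
  induction hT with
  | linear Γ S φ l h₁ h₂ =>
    obtain ⟨v, hv⟩ := h
    by_cases hS : (S : Set (Mark F)) ⊆ A
    · obtain ⟨v', h₃, h₄⟩ := M.linear i v _ φ l (mem_nodeForms_of_prop h₁) h₂ (hv S φ h₁ hS)
      exact M.faithful_union v v' hv h₃ fun _ => h₄
    · exact M.faithful_union v v hv (fun _ _ h => h) fun h => absurd h hS
  | branching Γ S φ a b h₁ h₂ =>
    obtain ⟨v, hv⟩ := h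
    by_cases hS : (S : Set (Mark F)) ⊆ A
    · refine (M.branching i v φ a b h₂ (hv S φ h₁ hS)).imp (fun h => ?_) fun h => ?_
      · exact M.faithful_union v v hv (fun _ _ h => h) fun _ => by simpa using h
      · exact M.faithful_union v v hv (fun _ _ h => h) fun _ => by simpa using h
    · exact .inl (M.faithful_union v v hv (fun _ _ h => h) fun h => absurd h hS)
  | close Γ S S' φ h₁ h₂ =>
    obtain ⟨v, hv⟩ := h
    refine M.faithful_union v v hv (fun _ _ h => h) fun hS => ?_
    rw [Finset.coe_union, Set.union_subset_iff] at hS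
    exact absurd (hv S φ h₁ hS.1) ((M.satN_neg i v φ).1 (hv S' _ h₂ hS.2))
  | inOne Γ T T' _ ih => exact ih h
  | inLeft Γ T₁ T₁' T₂ _ ih => exact h.imp ih id
  | inRight Γ T₁ T₂ T₂' _ ih => exact h.imp id ih

/-- Soundness of tableaux: whatever makes the marks in `A` true makes true everything in some leaf
that is supported by `A`. -/
theorem anyLeaf_faithful {T : Tree F N} (hT : IsTableau 𝓛 K D Q T) {i : M.Interp}
    {A : Set (Mark F)} (hA : ∀ m ∈ A, M.MarkHolds i m) : T.AnyLeaf (M.Faithful i A) := by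
  induction hT with
  | start =>
    obtain ⟨v⟩ := M.nonempty_assign i
    refine ⟨v, ?_⟩
    rintro U χ (⟨σ, -, h⟩ | ⟨φ, -, h⟩) hU
    · cases h
      rw [M.satN_emb]
      exact hA (.elem (.prop σ)) (hU (by simp)) σ (Elem.claim_prop σ)
    · cases h
      rw [M.satN_neg, M.satN_emb]
      exact hA (.test φ) (hU (by simp))
  | step T T' _ hs ih => exact M.anyLeaf_faithful_step hs ih
  | extend T S r _ _ _ ih =>
    refine ih.extend fun Γ => ?_
    rintro ⟨v, hv⟩
    refine ⟨v, ?_⟩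
    rintro U χ (h | h) hU
    · obtain ⟨rfl, h⟩ := Prod.ext_iff.1 h
      have hr := hA (.elem (.rule S r)) (hU (elem_mem_marks.2 (Finset.mem_singleton_self _)))
      obtain ⟨ante, φ | ⟨η, μ⟩⟩ := r
      · obtain rfl : χ = 𝓛.emb φ := Stmt.prop.inj h
        rw [M.satN_emb]
        exact hr φ (Elem.claim_rule _ _)
      · cases h
    · exact hv U χ h hU

theorem not_isClosureSupport_of_faithful {T : Tree F N} {i : M.Interp} {A : Set (Mark F)}
    (h : T.AnyLeaf (M.Faithful i A)) {U : Finset (Mark F)} (hU : T.IsClosureSupport 𝓛 U)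
    (hUA : ↑U ⊆ A) : False := by
  induction T generalizing U with
  | leaf Γ =>
    obtain ⟨v, hv⟩ := h
    exact M.not_satN_bot i v (hv U _ hU hUA)
  | one Γ T ih => exact ih h hU hUA
  | two Γ T₁ T₂ ih₁ ih₂ =>
    obtain ⟨U₁, U₂, h₁, h₂, rfl⟩ := hU
    rw [Finset.coe_union, Set.union_subset_iff] at hUA
    exact h.elim (fun h => ih₁ h h₁ hUA.1) fun h => ih₂ h h₂ hUA.2

end Semantics

/-- If at most the test for `φ` is used to close a tableau, then the supporting statements entail
`φ`. -/
theorem Semantics.entailsStmt_hat (M : Semantics.{w, x, y} 𝓛) {T : Tree F N}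
    (hT : IsTableau 𝓛 K D Q T) {U : Finset (Mark F)}
    (hU : T.IsClosureSupport 𝓛 U) {S : Finset (Elem F)} {φ : F}
    (hUS : U ⊆ insert (Mark.test φ) (marks S)) : 𝓛.EntailsStmt (hat S) (.prop φ) := by
  refine (M.entails_iff _ φ).2 fun i hi => by_contra fun hφ => ?_
  refine M.not_isClosureSupport_of_faithful (M.anyLeaf_faithful (i := i) hT (A := ↑U) ?_) hU
    subset_rfl
  intro m hm
  obtain rfl | hm := Finset.mem_insert.1 (hUS hm)
  · exact hφ
  · obtain ⟨e, he, rfl⟩ := Finset.mem_image.1 hm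
    exact fun χ hχ => hi χ ⟨e, he, hχ⟩

theorem Semantics.entailsStmt_hat_of_determines (M : Semantics.{w, x, y} 𝓛)
    {T : Tree F N} (hT : IsTableau 𝓛 K D Q T)
    {S : Finset (Elem F)} {φ : F} (h : Determines 𝓛 T S φ) :
    𝓛.EntailsStmt (hat S) (.prop φ) :=
  h.2.elim (fun h => M.entailsStmt_hat hT h subset_rfl)
    fun h => M.entailsStmt_hat hT h (Finset.subset_insert _ _)

/-- All supporting elements in the node may occur in supports of arguments. -/
def ValidNode (𝓛 : TableauLogic F N) (K : Set F) (D : Set (Rule F)) (Γ : Set (Entry F N)) : Prop :=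
  ∀ U χ, (U, χ) ∈ Γ → ∀ e, Mark.elem e ∈ U → IsValidElem 𝓛 K D e

theorem ValidNode.union_entries {Γ : Set (Entry F N)} (h : ValidNode 𝓛 K D Γ)
    {S : Finset (Mark F)} (hS : ∀ e, Mark.elem e ∈ S → IsValidElem 𝓛 K D e) (l : List N) :
    ValidNode 𝓛 K D (Γ ∪ entries S l) := by
  rintro U χ (h' | ⟨χ', -, h'⟩) e he
  · exact h U χ h' e he
  · cases h'
    exact hS e he

theorem isInherited_validNode : IsInherited 𝓛 (ValidNode 𝓛 K D) where
  linear _ S _ l h h₁ _ := h.union_entries (h S _ h₁) l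
  branching _ S _ _ _ h h₁ _ := ⟨h.union_entries (h S _ h₁) _, h.union_entries (h S _ h₁) _⟩
  close _ S S' _ h h₁ h₂ := h.union_entries
    (fun e he => (Finset.mem_union.1 he).elim (h S _ h₁ e) (h S' _ h₂ e)) _

theorem Tree.IsClosureSupport.isValidElem {T : Tree F N} (hT : T.AllLeaves (ValidNode 𝓛 K D))
    {U : Finset (Mark F)} (hU : T.IsClosureSupport 𝓛 U) {e : Elem F} (he : Mark.elem e ∈ U) :
    IsValidElem 𝓛 K D e := by
  induction T generalizing U with
  | leaf Γ => exact hT U _ hU e he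
  | one Γ T ih => exact ih hT hU he
  | two Γ T₁ T₂ ih₁ ih₂ =>
    obtain ⟨U₁, U₂, h₁, h₂, rfl⟩ := hU
    exact (Finset.mem_union.1 he).elim (ih₁ hT.1 h₁) (ih₂ hT.2 h₂)

theorem Semantics.isArgument_of_determines_of_validNode (M : Semantics.{w, x, y} 𝓛) {T : Tree F N}
    (hT : IsTableau 𝓛 K D Q T) (hT' : T.AllLeaves (ValidNode 𝓛 K D)) {S : Finset (Elem F)} {φ : F}
    (h : Determines 𝓛 T S φ) : IsArgument 𝓛 K D S (.prop φ) := by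
  refine .of_entailsStmt_hat (fun e he => ?_) (M.entailsStmt_hat_of_determines hT h)
  obtain ⟨-, h | h⟩ := h
  · exact h.isValidElem hT' (Finset.mem_insert_of_mem (elem_mem_marks.2 he))
  · exact h.isValidElem hT' (elem_mem_marks.2 he)

theorem Semantics.allLeaves_validNode (M : Semantics.{w, x, y} 𝓛) {T : Tree F N}
    (hT : IsTableau 𝓛 K D Q T) : T.AllLeaves (ValidNode 𝓛 K D) := by
  induction hT with
  | start =>
    rintro U χ (⟨σ, hσ, h⟩ | ⟨φ, -, h⟩) e he
    · cases h
      exact .inl ⟨σ, hσ, by simpa using he⟩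
    · cases h
      simp at he
  | step T T' _ hs ih => exact hs.allLeaves isInherited_validNode ih
  | extend T S r hT hr hS ih =>
    refine ih.extend fun Γ h => ?_
    rintro U χ (h' | h') e he
    · cases h'
      exact .inr ⟨S, r, hr, M.isArgument_of_determines_of_validNode hT ih hS,
        Finset.mem_singleton.1 (elem_mem_marks.1 he)⟩
    · exact h U χ h' e he

theorem Semantics.isArgument_of_determines (M : Semantics.{w, x, y} 𝓛) {T : Tree F N}
    (hT : IsTableau 𝓛 K D Q T) {S : Finset (Elem F)} {φ : F}
    (h : Determines 𝓛 T S φ) : IsArgument 𝓛 K D S (.prop φ) :=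
  M.isArgument_of_determines_of_validNode hT (M.allLeaves_validNode hT) h

theorem Semantics.isArgument_of_mem_root (M : Semantics.{w, x, y} 𝓛)
    (hemb : Function.Injective 𝓛.emb) {T : Tree F N}
    (hT : IsTableau 𝓛 K D Q T) {S : Finset (Elem F)} {η : F} {μ : Stmt F}
    (h : (marks S, (Stmt.notRule η μ).map 𝓛.emb) ∈ T.root) :
    IsArgument 𝓛 K D S (.notRule η μ) := by
  induction hT with
  | start => obtain ⟨σ, -, h⟩ | ⟨φ, -, h⟩ := h <;> cases (Prod.ext_iff.1 h).2
  | step T T' _ hs ih => exact ih (hs.root_eq ▸ h)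
  | extend T S' r hT hr hS ih =>
    rw [Tree.root_extend] at h
    obtain h | h := h
    · obtain ⟨h₁, h₂⟩ := Prod.ext_iff.1 h
      rw [marks_injective h₁, Stmt.map_injective hemb h₂]
      exact .defeasible S' r (M.isArgument_of_determines hT hS) hr
    · exact ih h

theorem Semantics.isArgument_of_derivable (M : Semantics.{w, x, y} 𝓛)
    (hemb : Function.Injective 𝓛.emb) {S : Finset (Elem F)} {ψ : Stmt F}
    (h : Derivable 𝓛 K D Q S ψ) : IsArgument 𝓛 K D S ψ := by
  cases ψ with
  | prop φ =>
    obtain ⟨T, hT, h⟩ := h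
    exact M.isArgument_of_determines hT h
  | notRule η μ =>
    obtain ⟨T, hT, h⟩ := h
    exact M.isArgument_of_mem_root hemb hT h

/-! ### Closing tableaux -/

/-- The one-node tableau `Γ` can be developed by tableau rules into a closed one, with a support
for its closure that is contained in `A`. -/
def Closable (𝓛 : TableauLogic F N) (A : Set (Mark F)) (Γ : Set (Entry F N)) : Prop :=
  ∃ T U, Relation.ReflTransGen (Step 𝓛) (.leaf Γ) T ∧ T.IsClosureSupport 𝓛 U ∧ ↑U ⊆ A

theorem Steps.one (Γ : Set (Entry F N)) {T T' : Tree F N}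
    (h : Relation.ReflTransGen (Step 𝓛) T T') :
    Relation.ReflTransGen (Step 𝓛) (.one Γ T) (.one Γ T') :=
  h.lift _ fun _ _ h => .inOne Γ _ _ h

theorem Steps.two (Γ : Set (Entry F N)) {T₁ T₁' T₂ T₂' : Tree F N}
    (h₁ : Relation.ReflTransGen (Step 𝓛) T₁ T₁') (h₂ : Relation.ReflTransGen (Step 𝓛) T₂ T₂') :
    Relation.ReflTransGen (Step 𝓛) (.two Γ T₁ T₂) (.two Γ T₁' T₂') :=
  (h₁.lift (fun T => Tree.two Γ T T₂) fun _ _ h => .inLeft Γ _ _ _ h).trans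
    (h₂.lift (fun T => Tree.two Γ T₁' T) fun _ _ h => .inRight Γ _ _ _ h)

theorem exists_steps_of_allLeaves_closable {A : Set (Mark F)} {T : Tree F N}
    (h : T.AllLeaves (Closable 𝓛 A)) :
    ∃ T' U, Relation.ReflTransGen (Step 𝓛) T T' ∧ T'.IsClosureSupport 𝓛 U ∧ ↑U ⊆ A := by
  induction T with
  | leaf Γ => exact h
  | one Γ T ih =>
    obtain ⟨T', U, h₁, h₂, h₃⟩ := ih h
    exact ⟨.one Γ T', U, Steps.one Γ h₁, h₂, h₃⟩
  | two Γ T₁ T₂ ih₁ ih₂ =>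
    obtain ⟨T₁', U₁, h₁, h₁', hU₁⟩ := ih₁ h.1
    obtain ⟨T₂', U₂, h₂, h₂', hU₂⟩ := ih₂ h.2
    refine ⟨.two Γ T₁' T₂', U₁ ∪ U₂, Steps.two Γ h₁ h₂, ⟨U₁, U₂, h₁', h₂', rfl⟩, ?_⟩
    rw [Finset.coe_union]
    exact Set.union_subset hU₁ hU₂

theorem Closable.of_bot {A : Set (Mark F)} {Γ : Set (Entry F N)} {U : Finset (Mark F)}
    (hU : ↑U ⊆ A) (h : (U, Stmt.prop 𝓛.bot) ∈ Γ) : Closable 𝓛 A Γ :=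
  ⟨.leaf Γ, U, .refl, h, hU⟩

theorem Closable.of_step_one {A : Set (Mark F)} {Γ Γ' : Set (Entry F N)}
    (hs : Step 𝓛 (.leaf Γ) (.one Γ (.leaf Γ'))) (h : Closable 𝓛 A Γ') : Closable 𝓛 A Γ := by
  obtain ⟨T, U, h₁, h₂, h₃⟩ := h
  exact ⟨.one Γ T, U, .head hs (Steps.one Γ h₁), h₂, h₃⟩

theorem Closable.of_step_two {A : Set (Mark F)} {Γ Γ₁ Γ₂ : Set (Entry F N)}
    (hs : Step 𝓛 (.leaf Γ) (.two Γ (.leaf Γ₁) (.leaf Γ₂))) (h₁ : Closable 𝓛 A Γ₁)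
    (h₂ : Closable 𝓛 A Γ₂) : Closable 𝓛 A Γ := by
  obtain ⟨T, U, h₃, h₄, h₅⟩ := exists_steps_of_allLeaves_closable
    (T := .two Γ (.leaf Γ₁) (.leaf Γ₂)) ⟨h₁, h₂⟩
  exact ⟨T, U, .head hs h₃, h₄, h₅⟩

theorem Closable.of_neg {A : Set (Mark F)} {Γ : Set (Entry F N)} {U U' : Finset (Mark F)} {φ : N}
    (hU : ↑U ⊆ A) (hU' : ↑U' ⊆ A) (h : (U, Stmt.prop φ) ∈ Γ)
    (h' : (U', Stmt.prop (𝓛.neg φ)) ∈ Γ) : Closable 𝓛 A Γ := by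
  refine .of_step_one (.close Γ U U' φ h h') (.of_bot (U := U ∪ U') ?_ (.inr ⟨_, by simp, rfl⟩))
  rw [Finset.coe_union]
  exact Set.union_subset hU hU'

/-! ### Deriving minimal arguments -/

/-- `good` holds, at every leaf of a tableau, of the set of formulas there. -/
structure IsInvariant (𝓛 : TableauLogic F N) (good : Set N → Prop) : Prop where
  anti : ∀ Γ Γ', Γ ⊆ Γ' → good Γ' → good Γ
  linear : ∀ Γ φ l, good Γ → φ ∈ Γ → 𝓛.Linear Γ φ l → good (Γ ∪ {χ | χ ∈ l})
  branching : ∀ Γ φ a b, good Γ → φ ∈ Γ → 𝓛.Branching φ a b → good (Γ ∪ {a}) ∧ good (Γ ∪ {b})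
  bot : ∀ Γ, good Γ → good (Γ ∪ {𝓛.bot})
  emb : ∀ Γ X, good Γ → good (Γ ∪ 𝓛.emb '' X)
  init : ∀ X, good (𝓛.emb '' X ∪ (fun φ => 𝓛.neg (𝓛.emb φ)) '' X)

theorem IsInvariant.isInherited {good : Set N → Prop} (h : IsInvariant 𝓛 good) :
    IsInherited 𝓛 (fun Γ => good (nodeForms Γ)) where
  linear Γ S φ l h₀ h₁ h₂ := h.anti _ _ (nodeForms_union_entries Γ S l)
    (h.linear _ φ l h₀ (mem_nodeForms_of_prop h₁) h₂)
  branching Γ S φ a b h₀ h₁ h₂ := by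
    obtain ⟨ha, hb⟩ := h.branching _ φ a b h₀ (mem_nodeForms_of_prop h₁) h₂
    exact ⟨h.anti _ _ ((nodeForms_union_entries Γ S [a]).trans (by simp)) ha,
      h.anti _ _ ((nodeForms_union_entries Γ S [b]).trans (by simp)) hb⟩
  close Γ S S' φ h₀ _ _ :=
    h.anti _ _ ((nodeForms_union_entries Γ (S ∪ S') [𝓛.bot]).trans (by simp)) (h.bot _ h₀)

theorem IsInvariant.allLeaves {good : Set N → Prop} (h : IsInvariant 𝓛 good) {T : Tree F N}
    (hT : IsTableau 𝓛 K D Q T) : T.AllLeaves (fun Γ => good (nodeForms Γ)) := by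
  induction hT with
  | start =>
    refine h.anti _ _ ?_ (h.init (K ∪ Q))
    rintro χ ⟨e, ⟨σ, hσ, rfl⟩ | ⟨φ, hφ, rfl⟩, rfl⟩
    · exact .inl ⟨σ, .inl hσ, rfl⟩
    · exact .inr ⟨φ, .inr hφ, rfl⟩
  | step T T' _ hs ih => exact hs.allLeaves h.isInherited ih
  | extend T S r _ _ _ ih =>
    refine ih.extend fun Γ hΓ => h.anti _ _ ?_ (h.emb _ r.cons.forms hΓ)
    rintro χ ⟨e, rfl | he, hχ⟩
    · exact .inr (by rwa [← Stmt.forms_map])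
    · exact .inl ⟨e, he, hχ⟩

/-- The tableau rules are complete at nodes satisfying `good`: if finitely many propositions
supported by `A` are jointly unsatisfiable then the node can be closed with a support in `A`. -/
def IsComplete (𝓛 : TableauLogic F N) (good : Set N → Prop) : Prop :=
  ∀ (A : Set (Mark F)) (Γ : Set (Entry F N)) (X : Set F) (φ : F), good (nodeForms Γ) →
    X.Finite → 𝓛.Entails X φ → (∀ χ ∈ X, ∃ U : Finset (Mark F), ↑U ⊆ A ∧
      (U, Stmt.prop (𝓛.emb χ)) ∈ Γ) →
    (∃ U : Finset (Mark F), ↑U ⊆ A ∧ (U, Stmt.prop (𝓛.neg (𝓛.emb φ))) ∈ Γ) → Closable 𝓛 A Γ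

section Complete

variable {good : Set N → Prop}

/-- If the root of a tableau contains the members of the support of a minimal argument, and the
test for its conclusion, then the tableau can be continued to one that determines this support:
by completeness it can be closed with a support contained in the given one, and by soundness and
minimality no element of the latter is missing. -/
theorem exists_determines (M : Semantics.{w, x, y} 𝓛) (hgood : IsInvariant 𝓛 good)
    (hcomp : IsComplete 𝓛 good) {T : Tree F N} (hT : IsTableau 𝓛 K D Q T) {S : Finset (Elem F)}
    {φ : F} (hS : ∀ e ∈ S, (marks {e}, e.claim.map 𝓛.emb) ∈ T.root)
    (hφ : testEntry 𝓛 φ ∈ T.root) (h : 𝓛.EntailsStmt (hat S) (.prop φ))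
    (hmin : ∀ S' : Finset (Elem F), S' ⊂ S → ¬ 𝓛.EntailsStmt (hat S') (.prop φ)) :
    ∃ T', IsTableau 𝓛 K D Q T' ∧ T.root ⊆ T'.root ∧ Determines 𝓛 T' S φ := by
  let A : Finset (Mark F) := insert (.test φ) (marks S)
  have hclos : T.AllLeaves (Closable 𝓛 A) := by
    have h₃ := hT.root_subset.and (hgood.allLeaves hT)
    refine h₃.mono fun Γ ⟨hΓ, hg⟩ => hcomp A Γ _ φ hg ?_ h ?_ ?_
    · refine Set.Finite.preimage (fun _ _ _ _ h => Stmt.prop.inj h) (s := hat S) ?_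
      exact (S.finite_toSet.image Elem.claim).subset fun χ ⟨e, he, h⟩ => ⟨e, he, h⟩
    · rintro χ ⟨e, he, hχ⟩
      refine ⟨marks {e}, ?_, ?_⟩
      · intro m hm
        obtain ⟨e', he', rfl⟩ := Finset.mem_image.1 (Finset.mem_coe.1 hm)
        rw [Finset.mem_singleton.1 he']
        exact Finset.mem_insert_of_mem (elem_mem_marks.2 he)
      · have := hΓ (hS e he)
        rwa [hχ] at this
    · refine ⟨{.test φ}, ?_, by exact hΓ hφ⟩
      simp [A]
  obtain ⟨T', U, h₁, h₂, h₃⟩ := exists_steps_of_allLeaves_closable hclos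
  have hT' := hT.steps h₁
  refine ⟨T', hT', (Steps.root_eq h₁).ge, (Steps.root_eq h₁).ge hφ, ?_⟩
  have hSU : S ⊆ S.filter fun e => Mark.elem e ∈ U := by
    by_contra hn
    refine hmin _ ⟨Finset.filter_subset _ _, hn⟩ (M.entailsStmt_hat hT' h₂ fun m hm => ?_)
    obtain rfl | hm' := Finset.mem_insert.1 (h₃ hm)
    · exact Finset.mem_insert_self _ _
    · obtain ⟨e, he, rfl⟩ := Finset.mem_image.1 hm'
      exact Finset.mem_insert_of_mem (elem_mem_marks.2 (Finset.mem_filter.2 ⟨he, hm⟩))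
  have hsub : marks S ⊆ U := by
    intro m hm
    obtain ⟨e, he, rfl⟩ := Finset.mem_image.1 hm
    exact (Finset.mem_filter.1 (hSU he)).2
  by_cases ht : Mark.test φ ∈ U
  · left
    have hU : U = insert (.test φ) (marks S) :=
      Finset.Subset.antisymm (Finset.coe_subset.1 h₃) (Finset.insert_subset ht hsub)
    rwa [← hU]
  · right
    rwa [Finset.Subset.antisymm hsub ((Finset.subset_insert_iff_of_notMem ht).1
      (Finset.coe_subset.1 h₃))]

theorem IsMinimalArgument.spec {S : Finset (Elem F)} {ψ : Stmt F}
    (h : IsMinimalArgument 𝓛 K D S ψ) :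
    IsArgument 𝓛 K D S ψ ∧ 𝓛.EntailsStmt (hat S) ψ ∧
      (∀ S' : Finset (Elem F), S' ⊂ S → ¬ 𝓛.EntailsStmt (hat S') ψ) ∧
      ∀ (S' : Finset (Elem F)) (r : Rule F), Elem.rule S' r ∈ S →
        IsMinimalArgument 𝓛 K D S' (.prop r.ante) := by
  cases h with
  | mk _ _ h₁ h₂ h₃ h₄ => exact ⟨h₁, h₂, h₃, h₄⟩

/-- A tableau may be continued so that its root contains all members of a finite set, if this is
so for each member separately. -/
theorem exists_extension_of_forall {S : Finset (Elem F)}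
    (hS : ∀ e ∈ S, ∀ T, IsTableau 𝓛 K D Q T → ∃ T', IsTableau 𝓛 K D Q T' ∧ T.root ⊆ T'.root ∧
      (marks {e}, e.claim.map 𝓛.emb) ∈ T'.root) {T : Tree F N} (hT : IsTableau 𝓛 K D Q T) :
    ∃ T', IsTableau 𝓛 K D Q T' ∧ T.root ⊆ T'.root ∧
      ∀ e ∈ S, (marks {e}, e.claim.map 𝓛.emb) ∈ T'.root := by
  induction S using Finset.induction_on with
  | empty => exact ⟨T, hT, subset_rfl, by simp⟩
  | insert e S _ ih =>
    obtain ⟨T₁, hT₁, h₁, h₁'⟩ := ih fun e' he' => hS e' (Finset.mem_insert_of_mem he')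
    obtain ⟨T₂, hT₂, h₂, h₂'⟩ := hS e (Finset.mem_insert_self _ _) T₁ hT₁
    refine ⟨T₂, hT₂, h₁.trans h₂, fun e' he' => ?_⟩
    obtain rfl | he' := Finset.mem_insert.1 he'
    · exact h₂'
    · exact h₂ (h₁' e' he')

/-- A rule whose antecedent has a minimal argument can be applied in an extension of any tableau
with the required tests: the members of the support are brought into the root recursively, and then
the antecedent is determined with exactly this support. -/
theorem exists_extension_mem_root (M : Semantics.{w, x, y} 𝓛) (hgood : IsInvariant 𝓛 good)
    (hcomp : IsComplete 𝓛 good) (hQ : ∀ r ∈ D, r.ante ∈ Q) (e : Elem F)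
    (he : IsValidElem 𝓛 K D e)
    (hmin : ∀ S r, e = .rule S r → IsMinimalArgument 𝓛 K D S (.prop r.ante))
    (T : Tree F N) (hT : IsTableau 𝓛 K D Q T) :
    ∃ T', IsTableau 𝓛 K D Q T' ∧ T.root ⊆ T'.root ∧
      (marks {e}, e.claim.map 𝓛.emb) ∈ T'.root := by
  induction e using Elem.induction generalizing T with
  | hprop φ =>
    obtain ⟨σ, hσ, h⟩ | ⟨S, r, -, -, h⟩ := he
    · refine ⟨T, hT, subset_rfl, hT.initialRoot_subset (.inl ⟨σ, hσ, ?_⟩)⟩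
      rw [h, Elem.claim_prop]
      simp [marks, Stmt.map]
    · exact absurd h (Elem.prop_ne_rule _ _ _)
  | hrule S r ih =>
    obtain ⟨σ, -, h⟩ | ⟨S', r', hr, -, h⟩ := he
    · exact absurd h.symm (Elem.prop_ne_rule _ _ _)
    obtain ⟨rfl, rfl⟩ := Elem.rule_inj h
    obtain ⟨harg, hent, hmin', hsub⟩ := (hmin S r rfl).spec
    obtain ⟨T₁, hT₁, h₁, h₁'⟩ := exists_extension_of_forall (S := S) (fun e he T hT =>
      ih e he (harg.isValidElem e he) (fun S' r' h => hsub S' r' (h ▸ he)) T hT) hT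
    obtain ⟨T₂, hT₂, h₂, h₂'⟩ := exists_determines M hgood hcomp hT₁ h₁'
      (hT₁.initialRoot_subset (.inr ⟨_, hQ r hr, rfl⟩)) hent hmin'
    refine ⟨_, .extend T₂ S r hT₂ hr h₂', ?_, ?_⟩
    · rw [Tree.root_extend]
      exact (h₁.trans h₂).trans (Set.subset_insert _ _)
    · rw [Tree.root_extend, Elem.claim_rule]
      exact Set.mem_insert _ _

theorem derivable_of_isMinimalArgument (M : Semantics.{w, x, y} 𝓛) (hgood : IsInvariant 𝓛 good)
    (hcomp : IsComplete 𝓛 good) {S : Finset (Elem F)} {ψ : Stmt F}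
    (h : IsMinimalArgument 𝓛 K D S ψ) : Derivable 𝓛 K D (testsFor D ψ) S ψ := by
  obtain ⟨harg, hent, hmin, hsub⟩ := h.spec
  obtain ⟨T, hT, -, hST⟩ := exists_extension_of_forall (S := S) (fun e he T hT =>
    exists_extension_mem_root M hgood hcomp (Q := testsFor D ψ)
      (fun r hr => .inl ⟨r, hr, rfl⟩) e (harg.isValidElem e he)
      (fun S' r' h => hsub S' r' (h ▸ he)) T hT) .start
  cases ψ with
  | prop φ =>
    obtain ⟨T', hT', -, h⟩ := exists_determines M hgood hcomp hT hST
      (hT.initialRoot_subset (.inr ⟨φ, .inr rfl, rfl⟩)) hent hmin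
    exact ⟨T', hT', h⟩
  | notRule η μ =>
    obtain ⟨e, he, hclaim⟩ := hent
    -- A negated rule follows only from itself, so a minimal support is a singleton.
    have hS : S = {e} := by
      by_contra hne
      exact hmin {e} ((Finset.singleton_subset_iff.2 he).ssubset_of_ne (Ne.symm hne))
        ⟨e, Finset.mem_singleton_self e, hclaim⟩
    refine ⟨T, hT, ?_⟩
    rw [hS, ← hclaim]
    exact hST e he

end Complete

end

/-! ### Saturation of open sets of formulas -/

/-- Repeated extension.  If every active requirement on a consistent set can be met by a larger
consistent set, and only finitely many requirements are active at a time, then some ascending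
sequence of consistent sets has a union that meets all requirements active on it. -/
theorem exists_saturated_sequence {N : Type u} {ι : Type v} {con : Set N → Prop}
    {active : Set N → Set ι} {sat : ι → Set N → Prop} (hfin : ∀ B, con B → (active B).Finite)
    (hmono : Monotone active) (hsat : ∀ i, Monotone (sat i))
    (hcont : ∀ B : ℕ → Set N, Monotone B → active (⋃ n, B n) ⊆ ⋃ n, active (B n))
    (hext : ∀ B i, con B → i ∈ active B → ∃ B', B ⊆ B' ∧ con B' ∧ sat i B')
    {B₀ : Set N} (h₀ : con B₀) :
    ∃ B : ℕ → Set N, Monotone B ∧ B 0 = B₀ ∧ (∀ n, con (B n)) ∧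
      ∀ i ∈ active (⋃ n, B n), sat i (⋃ n, B n) := by
  have hround : ∀ B, con B → ∃ B', B ⊆ B' ∧ con B' ∧ ∀ i ∈ active B, sat i B' := by
    intro B hB
    have key : ∀ I : Finset ι, ↑I ⊆ active B → ∃ B', B ⊆ B' ∧ con B' ∧ ∀ i ∈ I, sat i B' := by
      intro I
      induction I using Finset.induction_on with
      | empty => exact fun _ => ⟨B, subset_rfl, hB, by simp⟩
      | insert i I _ ih =>
        intro hI
        rw [Finset.coe_insert, Set.insert_subset_iff] at hI
        obtain ⟨B₁, h₁, hB₁, hs₁⟩ := ih hI.2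
        obtain ⟨B₂, h₂, hB₂, hs₂⟩ := hext B₁ i hB₁ (hmono h₁ hI.1)
        refine ⟨B₂, h₁.trans h₂, hB₂, fun j hj => ?_⟩
        obtain rfl | hj := Finset.mem_insert.1 hj
        · exact hs₂
        · exact hsat j h₂ (hs₁ j hj)
    obtain ⟨B', h₁, h₂, h₃⟩ := key (hfin B hB).toFinset (by simp)
    exact ⟨B', h₁, h₂, fun i hi => h₃ i (by simpa using hi)⟩
  choose f hf using hround
  let g : ℕ → {B // con B} := fun n => Nat.rec ⟨B₀, h₀⟩ (fun _ B => ⟨f B.1 B.2, (hf B.1 B.2).2.1⟩) n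
  have hg : Monotone fun n => (g n).1 := monotone_nat_of_le_succ fun n => (hf (g n).1 (g n).2).1
  refine ⟨fun n => (g n).1, hg, rfl, fun n => (g n).2, fun i hi => ?_⟩
  obtain ⟨n, hn⟩ := Set.mem_iUnion.1 (hcont _ hg hi)
  exact hsat i (Set.subset_iUnion (fun n => (g n).1) (n + 1)) ((hf (g n).1 (g n).2).2.2 i hn)

section

variable {F N : Type w}

/-- A finite set of formulas that are supported by `A` in some node that cannot be closed with a
support contained in `A`. -/
def IsOpenSet (𝓛 : TableauLogic F N) (good : Set N → Prop) (A : Set (Mark F)) (B : Set N) : Prop :=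
  B.Finite ∧ ∃ Γ : Set (Entry F N), good (nodeForms Γ) ∧
    (∀ χ ∈ B, ∃ U : Finset (Mark F), ↑U ⊆ A ∧ (U, Stmt.prop χ) ∈ Γ) ∧ ¬ Closable 𝓛 A Γ

variable {𝓛 : TableauLogic F N} {good : Set N → Prop} {A : Set (Mark F)} {B : Set N}

namespace IsOpenSet

theorem bot_notMem (h : IsOpenSet 𝓛 good A B) : 𝓛.bot ∉ B := by
  intro hB
  obtain ⟨-, Γ, -, hΓ, hn⟩ := h
  obtain ⟨U, hU, h⟩ := hΓ _ hB
  exact hn (.of_bot hU h)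

theorem neg_notMem (h : IsOpenSet 𝓛 good A B) {φ : N} (hφ : φ ∈ B) : 𝓛.neg φ ∉ B := by
  intro hB
  obtain ⟨-, Γ, -, hΓ, hn⟩ := h
  obtain ⟨U, hU, h⟩ := hΓ _ hφ
  obtain ⟨U', hU', h'⟩ := hΓ _ hB
  exact hn (.of_neg hU hU' h h')

/-- A contradiction in the union of an ascending sequence would already occur in a member. -/
theorem iUnion {B : ℕ → Set N} (hmono : Monotone B) (hB : ∀ n, IsOpenSet 𝓛 good A (B n)) :
    𝓛.bot ∉ (⋃ n, B n) ∧ ∀ φ ∈ ⋃ n, B n, 𝓛.neg φ ∉ ⋃ n, B n := by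
  refine ⟨fun h => ?_, fun φ h h' => ?_⟩
  · obtain ⟨n, hn⟩ := Set.mem_iUnion.1 h
    exact (hB n).bot_notMem hn
  · obtain ⟨n, hn⟩ := Set.mem_iUnion.1 h
    obtain ⟨m, hm⟩ := Set.mem_iUnion.1 h'
    exact (hB (max n m)).neg_notMem (hmono (le_max_left n m) hn) (hmono (le_max_right n m) hm)

theorem exists_linear (hgood : IsInvariant 𝓛 good) (h : IsOpenSet 𝓛 good A B) {φ : N} (hφ : φ ∈ B)
    {p : List N → Prop} (hl : ∀ Γ, good Γ → B ⊆ Γ → ∃ l, p l ∧ 𝓛.Linear Γ φ l) :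
    ∃ l, p l ∧ IsOpenSet 𝓛 good A (B ∪ {χ | χ ∈ l}) := by
  obtain ⟨hfin, Γ, hg, hΓ, hn⟩ := h
  obtain ⟨l, hpl, hl⟩ := hl _ hg fun χ hχ =>
    (hΓ χ hχ).elim fun U hU => mem_nodeForms_of_prop hU.2
  obtain ⟨U, hU, hφ⟩ := hΓ φ hφ
  refine ⟨l, hpl, hfin.union l.finite_toSet, Γ ∪ entries U l,
    hgood.isInherited.linear Γ U φ l hg hφ hl, ?_,
    fun hc => hn (.of_step_one (.linear Γ U φ l hφ hl) hc)⟩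
  rintro χ (hχ | hχ)
  · exact (hΓ χ hχ).imp fun V hV => ⟨hV.1, .inl hV.2⟩
  · exact ⟨U, hU, .inr ⟨χ, hχ, rfl⟩⟩

theorem branching (hgood : IsInvariant 𝓛 good) (h : IsOpenSet 𝓛 good A B) {φ a b : N} (hφ : φ ∈ B)
    (hab : 𝓛.Branching φ a b) : IsOpenSet 𝓛 good A (B ∪ {a}) ∨ IsOpenSet 𝓛 good A (B ∪ {b}) := by
  obtain ⟨hfin, Γ, hg, hΓ, hn⟩ := h
  obtain ⟨U, hU, hφ⟩ := hΓ φ hφ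
  have key : ∀ c, ∀ χ ∈ B ∪ {c}, ∃ V : Finset (Mark F), ↑V ⊆ A ∧
      (V, Stmt.prop χ) ∈ Γ ∪ entries U [c] := by
    rintro c χ (hχ | rfl)
    · exact (hΓ χ hχ).imp fun V hV => ⟨hV.1, .inl hV.2⟩
    · exact ⟨U, hU, .inr ⟨χ, by simp, rfl⟩⟩
  obtain ⟨ha, hb⟩ := hgood.isInherited.branching Γ U φ a b hg hφ hab
  by_cases hc : Closable 𝓛 A (Γ ∪ entries U [a])
  · exact .inr ⟨hfin.union (Set.finite_singleton b), _, hb, key b,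
      fun hc' => hn (.of_step_two (.branching Γ U φ a b hφ hab) hc hc')⟩
  · exact .inl ⟨hfin.union (Set.finite_singleton a), _, ha, key a, hc⟩

end IsOpenSet

/-- Completeness follows if no open set contains the negation of a consequence of its members. -/
theorem isComplete_of_isOpenSet
    (h : ∀ (A : Set (Mark F)) (X : Set F) (φ : F), 𝓛.Entails X φ →
      ¬ IsOpenSet 𝓛 good A (𝓛.emb '' X ∪ {𝓛.neg (𝓛.emb φ)})) : IsComplete 𝓛 good := by
  intro A Γ X φ hg hX hφ h₁ h₂
  by_contra hn
  refine h A X φ hφ ⟨(hX.image _).union (Set.finite_singleton _), Γ, hg, ?_, hn⟩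
  rintro χ (⟨χ, hχ, rfl⟩ | rfl)
  · exact h₁ χ hχ
  · exact h₂

end

/-! ### Propositional logic -/

namespace PropForm

variable {P : Type u}

/-- What a saturated set of formulas has to satisfy because it contains the given formula. -/
def Demand : PropForm P → Set (PropForm P) → Prop
  | and a b => fun H => a ∈ H ∧ b ∈ H
  | or a b => fun H => a ∈ H ∨ b ∈ H
  | imp a b => fun H => neg a ∈ H ∨ b ∈ H
  | iff a b => fun H => imp a b ∈ H ∧ imp b a ∈ H
  | neg (and a b) => fun H => neg a ∈ H ∨ neg b ∈ H
  | neg (or a b) => fun H => neg a ∈ H ∧ neg b ∈ H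
  | neg (imp a b) => fun H => a ∈ H ∧ neg b ∈ H
  | neg (iff a b) => fun H => neg (imp a b) ∈ H ∨ neg (imp b a) ∈ H
  | neg (neg a) => fun H => a ∈ H
  | _ => fun _ => True

theorem monotone_demand (φ : PropForm P) : Monotone φ.Demand := by
  intro H H' h
  unfold Demand
  split <;> simp only [le_Prop_eq] <;> grind

/-- The number of connectives, where `↔` counts as several, so that `a → b` and `b → a` are
simpler than `a ↔ b`. -/
def complexity : PropForm P → ℕ
  | bot => 0
  | atom _ => 0
  | neg a => a.complexity + 1
  | and a b => a.complexity + b.complexity + 1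
  | or a b => a.complexity + b.complexity + 1
  | imp a b => a.complexity + b.complexity + 1
  | iff a b => a.complexity + b.complexity + 2

/-- Truth lemma for saturated sets. -/
theorem sat_of_demand {H : Set (PropForm P)} (hbot : bot ∉ H) (hneg : ∀ φ ∈ H, neg φ ∉ H)
    (hH : ∀ φ ∈ H, φ.Demand H) (φ : PropForm P) :
    (φ ∈ H → φ.Sat fun p => atom p ∈ H) ∧ (neg φ ∈ H → ¬ φ.Sat fun p => atom p ∈ H) := by
  have h₁ := hH φ
  have h₂ := hH (neg φ)
  cases φ with
  | bot => exact ⟨fun h => hbot h, fun _ h => h⟩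
  | atom p => exact ⟨id, fun h h' => hneg _ h' h⟩
  | neg a =>
    have ha := sat_of_demand hbot hneg hH a
    exact ⟨ha.2, fun h h' => h' (ha.1 (h₂ h))⟩
  | and a b =>
    have ha := sat_of_demand hbot hneg hH a
    have hb := sat_of_demand hbot hneg hH b
    exact ⟨fun h => ⟨ha.1 (h₁ h).1, hb.1 (h₁ h).2⟩,
      fun h h' => (h₂ h).elim (fun h => ha.2 h h'.1) fun h => hb.2 h h'.2⟩
  | or a b =>
    have ha := sat_of_demand hbot hneg hH a
    have hb := sat_of_demand hbot hneg hH b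
    exact ⟨fun h => (h₁ h).imp ha.1 hb.1, fun h h' => h'.elim (ha.2 (h₂ h).1) (hb.2 (h₂ h).2)⟩
  | imp a b =>
    have ha := sat_of_demand hbot hneg hH a
    have hb := sat_of_demand hbot hneg hH b
    exact ⟨fun h h' => (h₁ h).elim (fun h => absurd h' (ha.2 h)) hb.1,
      fun h h' => hb.2 (h₂ h).2 (h' (ha.1 (h₂ h).1))⟩
  | iff a b =>
    have ha := sat_of_demand hbot hneg hH (imp a b)
    have hb := sat_of_demand hbot hneg hH (imp b a)
    exact ⟨fun h => ⟨ha.1 (h₁ h).1, hb.1 (h₁ h).2⟩,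
      fun h h' => (h₂ h).elim (fun h => ha.2 h h'.1) fun h => hb.2 h h'.2⟩
termination_by φ.complexity
decreasing_by all_goals simp only [complexity]; omega

/-- Two-valued semantics; there are no new constants. -/
def semantics (P : Type u) : Semantics.{u, u, 0} (propLogic P) where
  Interp := P → Prop
  Assign _ := Unit
  sat V φ := φ.Sat V
  satN V _ φ := φ.Sat V
  nonempty_assign _ := inferInstance
  entails_iff _ _ := Iff.rfl
  satN_emb _ _ _ := Iff.rfl
  satN_neg _ _ _ := Iff.rfl
  not_satN_bot _ _ h := h
  linear V v Γ φ l _ hl h := by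
    refine ⟨v, fun _ _ h => h, ?_⟩
    cases hl <;> simp only [Sat] at h <;> simp [Sat] <;> tauto
  branching V _ φ a b hab h := by
    cases hab <;> simp only [Sat] at h ⊢ <;> tauto

theorem isInvariant_true : IsInvariant (propLogic P) fun _ => True := by
  constructor <;> simp

theorem exists_isOpenSet_demand {A : Set (Mark (PropForm P))} {B : Set (PropForm P)}
    (hB : IsOpenSet (propLogic P) (fun _ => True) A B) {φ : PropForm P} (hφ : φ ∈ B) :
    ∃ B', B ⊆ B' ∧ IsOpenSet (propLogic P) (fun _ => True) A B' ∧ φ.Demand B' := by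
  have hlin : ∀ l, Linear φ l → ∃ B', B ⊆ B' ∧
      IsOpenSet (propLogic P) (fun _ => True) A B' ∧ ∀ χ ∈ l, χ ∈ B' := by
    intro l hl
    obtain ⟨_, rfl, h⟩ := hB.exists_linear isInvariant_true hφ (p := (· = l))
      fun _ _ _ => ⟨l, rfl, hl⟩
    exact ⟨_, Set.subset_union_left, h, fun χ hχ => .inr hχ⟩
  have hbr : ∀ a b, Branching φ a b → ∃ B', B ⊆ B' ∧
      IsOpenSet (propLogic P) (fun _ => True) A B' ∧ (a ∈ B' ∨ b ∈ B') := by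
    intro a b hab
    obtain h | h := hB.branching isInvariant_true hφ hab
    · exact ⟨_, Set.subset_union_left, h, .inl (.inr rfl)⟩
    · exact ⟨_, Set.subset_union_left, h, .inr (.inr rfl)⟩
  unfold Demand
  split
  · simpa using hlin _ (.and _ _)
  · exact hbr _ _ (.or _ _)
  · exact hbr _ _ (.imp _ _)
  · simpa using hlin _ (.iff _ _)
  · exact hbr _ _ (.neg_and _ _)
  · simpa using hlin _ (.neg_or _ _)
  · simpa using hlin _ (.neg_imp _ _)
  · exact hbr _ _ (.neg_iff _ _)
  · simpa using hlin _ (.neg_neg _)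
  · exact ⟨B, subset_rfl, hB, trivial⟩

theorem isComplete_propLogic : IsComplete (propLogic P) fun _ => True := by
  refine isComplete_of_isOpenSet fun A X φ hφ hopen => ?_
  obtain ⟨B, hmono, hB₀, hB, hH⟩ := exists_saturated_sequence (active := id) (sat := Demand)
    (fun B hB => hB.1) monotone_id monotone_demand (fun _ _ => subset_rfl)
    (fun B φ hB hφ => exists_isOpenSet_demand hB hφ) hopen
  have hsub : B 0 ⊆ ⋃ n, B n := Set.subset_iUnion B 0
  rw [hB₀] at hsub
  obtain ⟨hbot, hneg⟩ := IsOpenSet.iUnion hmono hB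
  have htruth := sat_of_demand hbot hneg hH
  exact (htruth φ).2 (hsub (.inr rfl)) (hφ _ fun χ hχ => (htruth χ).1 (hsub (.inl ⟨χ, hχ, rfl⟩)))

end PropForm

/-! ### Terms and substitution in predicate logic -/

section

variable {L : FirstOrder.Language.{u, v}} {α β : Type}

theorem TermOccurs.refl (t : L.Term α) : TermOccurs t t := by
  cases t
  · rfl
  · exact .inl rfl

theorem TermOccurs.trans {s t u : L.Term α} (hst : TermOccurs s t) (htu : TermOccurs t u) :
    TermOccurs s u := by
  induction u with
  | var b =>
    obtain rfl : t = .var b := htu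
    exact hst
  | func f ts ih =>
    obtain rfl | ⟨i, hi⟩ := htu
    · exact hst
    · exact .inr ⟨i, ih i hi⟩

theorem TermOccurs.relabel {s t : L.Term α} (h : TermOccurs s t) (g : α → β) :
    TermOccurs (s.relabel g) (t.relabel g) := by
  induction t with
  | var b =>
    obtain rfl : s = .var b := h
    exact .refl _
  | func f ts ih =>
    obtain rfl | ⟨i, hi⟩ := h
    · exact .refl _
    · exact .inr ⟨i, ih i hi⟩

theorem finite_setOf_termOccurs (t : L.Term α) : {s | TermOccurs s t}.Finite := by
  induction t with
  | var b => exact Set.finite_singleton _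
  | func f ts ih =>
    refine ((Set.finite_singleton (FirstOrder.Language.Term.func f ts)).union
      (Set.finite_iUnion ih)).subset ?_
    rintro s (h | ⟨i, hi⟩)
    · exact .inl h
    · exact .inr (Set.mem_iUnion.2 ⟨i, hi⟩)

theorem relabel_inl_injective :
    Function.Injective fun t : L.Term α => t.relabel (Sum.inl : α → α ⊕ β) := by
  intro s
  induction s with
  | var a =>
    rintro (b | ⟨f, ts⟩) h
    · cases h; rfl
    · cases h
  | func f ts ih =>
    rintro (b | ⟨f', ts'⟩) h
    · cases h
    · simp only [FirstOrder.Language.Term.relabel, FirstOrder.Language.Term.func.injEq] at h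
      obtain ⟨rfl, h₁, h₂⟩ := h
      obtain rfl := eq_of_heq h₁
      congr 1
      exact funext fun i => ih i (congrFun (eq_of_heq h₂) i)

/-- A new constant occurring after a substitution comes from the terms that are substituted. -/
theorem termOccurs_var_subst {γ : Type} {b : γ} {t : L.Term α} {f : α → L.Term γ}
    (h : TermOccurs (.var b) (t.subst f)) :
    ∃ a, TermOccurs (.var a) t ∧ TermOccurs (.var b) (f a) := by
  induction t with
  | var a => exact ⟨a, rfl, h⟩
  | func g ts ih =>
    obtain h | ⟨i, hi⟩ := h
    · cases h
    · obtain ⟨a, h₁, h₂⟩ := ih i hi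
      exact ⟨a, .inr ⟨i, h₁⟩, h₂⟩

theorem termOccurs_var_relabel {b : β} {t : L.Term α} {g : α → β}
    (h : TermOccurs (.var b) (t.relabel g)) : ∃ a, TermOccurs (.var a) t ∧ b = g a := by
  induction t with
  | var a =>
    cases h
    exact ⟨a, rfl, rfl⟩
  | func g ts ih =>
    obtain h | ⟨i, hi⟩ := h
    · cases h
    · obtain ⟨a, h₁, h₂⟩ := ih i hi
      exact ⟨a, .inr ⟨i, h₁⟩, h₂⟩

theorem realize_congr_of_termOccurs {M : Type w} [L.Structure M] {x x' : α → M} {t : L.Term α}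
    (h : ∀ a, TermOccurs (.var a) t → x a = x' a) : t.realize x = t.realize x' := by
  induction t with
  | var a => exact h a rfl
  | func f ts ih =>
    simp only [FirstOrder.Language.Term.realize]
    congr 1
    exact funext fun i => ih i fun a ha => h a (.inr ⟨i, ha⟩)

namespace PredForm

/-- The number of connectives and quantifiers, where `↔` counts as several, so that `a → b` and
`b → a` are simpler than `a ↔ b`. -/
def complexity : {n : ℕ} → PredForm L α n → ℕ
  | _, bot => 0
  | _, rel _ _ => 0
  | _, neg a => a.complexity + 1
  | _, and a b => a.complexity + b.complexity + 1
  | _, or a b => a.complexity + b.complexity + 1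
  | _, imp a b => a.complexity + b.complexity + 1
  | _, iff a b => a.complexity + b.complexity + 2
  | _, all a => a.complexity + 1
  | _, ex a => a.complexity + 1

theorem complexity_subst {n m : ℕ} (φ : PredForm L α n) (f : α ⊕ Fin n → L.Term (β ⊕ Fin m)) :
    (φ.subst f).complexity = φ.complexity := by
  induction φ generalizing m <;> simp [subst, complexity, *]

theorem complexity_inst (φ : PredForm L α 1) (t : L.Term α) :
    (φ.inst t).complexity = φ.complexity :=
  complexity_subst _ _

theorem realize_liftSubst {M : Type w} [L.Structure M] {n m : ℕ}
    (f : α ⊕ Fin n → L.Term (β ⊕ Fin m)) (x : β → M) (y : Fin m → M) (z : M) :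
    (fun i => (liftSubst f (.inr i)).realize (Sum.elim x (Fin.snoc y z))) =
      Fin.snoc (α := fun _ => M) (fun i => (f (.inr i)).realize (Sum.elim x y)) z ∧
    (fun a => (liftSubst f (.inl a)).realize (Sum.elim x (Fin.snoc y z))) =
      fun a => (f (.inl a)).realize (Sum.elim x y) := by
  have h : (Sum.elim x (Fin.snoc y z : Fin (m + 1) → M)) ∘ Sum.map id Fin.castSucc =
      Sum.elim x y := by
    ext (b | i) <;> simp
  constructor
  · funext i
    induction i using Fin.lastCases with
    | last => simp [liftSubst]
    | cast i => simp [liftSubst, h]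
  · funext a
    simp [liftSubst, h]

theorem sat_subst {M : Type w} [L.Structure M] {n m : ℕ} (φ : PredForm L α n)
    (f : α ⊕ Fin n → L.Term (β ⊕ Fin m)) (x : β → M) (y : Fin m → M) :
    (φ.subst f).Sat x y ↔ φ.Sat (fun a => (f (.inl a)).realize (Sum.elim x y))
      (fun i => (f (.inr i)).realize (Sum.elim x y)) := by
  induction φ generalizing m with
  | bot => exact Iff.rfl
  | rel R ts =>
    simp only [subst, Sat, FirstOrder.Language.Term.realize_subst]
    have : (fun a => (f a).realize (Sum.elim x y)) =
        Sum.elim (fun a => (f (.inl a)).realize (Sum.elim x y))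
          (fun i => (f (.inr i)).realize (Sum.elim x y)) := by
      ext (a | i) <;> rfl
    rw [this]
  | neg a iha => simp only [subst, Sat, iha]
  | and a b iha ihb => simp only [subst, Sat, iha, ihb]
  | or a b iha ihb => simp only [subst, Sat, iha, ihb]
  | imp a b iha ihb => simp only [subst, Sat, iha, ihb]
  | iff a b iha ihb => simp only [subst, Sat, iha, ihb]
  | all a iha => simp only [subst, Sat, iha, realize_liftSubst]
  | ex a iha => simp only [subst, Sat, iha, realize_liftSubst]

theorem sat_inst {M : Type w} [L.Structure M] (φ : PredForm L α 1) (t : L.Term α) (x : α → M)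
    (y : Fin 0 → M) : (φ.inst t).Sat x y ↔ φ.Sat x (Fin.snoc y (t.realize x)) := by
  rw [inst, sat_subst]
  have : (Fin.snoc y (t.realize x) : Fin 1 → M) = fun _ => t.realize x := by
    funext i
    obtain rfl : i = Fin.last 0 := Subsingleton.elim (α := Fin 1) _ _
    exact Fin.snoc_last (α := fun _ => M) _ _
  rw [this]
  simp [Function.comp_def]

theorem sat_substFree_elim {M : Type w} [L.Structure M] (φ : PredForm L Empty 0) (x : β → M)
    (y : Fin 0 → M) :
    (φ.substFree (β := β) Empty.elim).Sat x y ↔ φ.Sat (M := M) Empty.elim Fin.elim0 := by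
  rw [substFree, sat_subst]
  have h₁ : ∀ z z' : Empty → M, z = z' := fun z z' => funext fun e => e.elim
  have h₂ : ∀ z z' : Fin 0 → M, z = z' := fun z z' => funext fun e => e.elim0
  exact iff_of_eq (congrArg₂ (fun x y => Sat x φ y) (h₁ _ _) (h₂ _ _))

/-- Truth depends only on the values of the constants that occur. -/
theorem sat_congr {M : Type w} [L.Structure M] {n : ℕ} {φ : PredForm L α n} {x x' : α → M}
    {y : Fin n → M} (h : ∀ a, φ.Occurs (.var a) → x a = x' a) : φ.Sat x y ↔ φ.Sat x' y := by
  induction φ with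
  | bot => exact Iff.rfl
  | rel R ts =>
    simp only [Sat]
    have : ∀ i, (ts i).realize (Sum.elim x y) = (ts i).realize (Sum.elim x' y) := by
      refine fun i => realize_congr_of_termOccurs ?_
      rintro (a | j) ha
      · exact h a ⟨i, ha⟩
      · rfl
    simp only [this]
  | neg a iha => simp only [Sat, iha h]
  | and a b iha ihb =>
    simp only [Sat, iha fun c hc => h c (.inl hc), ihb fun c hc => h c (.inr hc)]
  | or a b iha ihb =>
    simp only [Sat, iha fun c hc => h c (.inl hc), ihb fun c hc => h c (.inr hc)]
  | imp a b iha ihb =>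
    simp only [Sat, iha fun c hc => h c (.inl hc), ihb fun c hc => h c (.inr hc)]
  | iff a b iha ihb =>
    simp only [Sat, iha fun c hc => h c (.inl hc), ihb fun c hc => h c (.inr hc)]
  | all a iha => exact forall_congr' fun m => iha h
  | ex a iha => exact exists_congr fun m => iha h

theorem finite_setOf_occurs {n : ℕ} (φ : PredForm L α n) : {t | φ.Occurs t}.Finite := by
  induction φ with
  | bot => exact Set.finite_empty
  | rel R ts =>
    refine (Set.finite_iUnion fun i => (finite_setOf_termOccurs (ts i)).preimage
      relabel_inl_injective.injOn).subset ?_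
    rintro t ⟨i, hi⟩
    exact Set.mem_iUnion.2 ⟨i, hi⟩
  | neg a iha => exact iha
  | and a b iha ihb => exact iha.union ihb
  | or a b iha ihb => exact iha.union ihb
  | imp a b iha ihb => exact iha.union ihb
  | iff a b iha ihb => exact iha.union ihb
  | all a iha => exact iha
  | ex a iha => exact iha

theorem Occurs.of_termOccurs {n : ℕ} {φ : PredForm L α n} {s t : L.Term α} (hst : TermOccurs s t)
    (h : φ.Occurs t) : φ.Occurs s := by
  induction φ with
  | bot => exact h
  | rel R ts => exact h.imp fun i hi => (hst.relabel _).trans hi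
  | neg a iha => exact iha h
  | and a b iha ihb => exact h.imp iha ihb
  | or a b iha ihb => exact h.imp iha ihb
  | imp a b iha ihb => exact h.imp iha ihb
  | iff a b iha ihb => exact h.imp iha ihb
  | all a iha => exact iha h
  | ex a iha => exact iha h

theorem occurs_var_subst {n m : ℕ} {φ : PredForm L α n} {f : α ⊕ Fin n → L.Term (β ⊕ Fin m)}
    {c : β} (h : (φ.subst f).Occurs (.var c)) :
    (∃ d, φ.Occurs (.var d) ∧ TermOccurs (.var (.inl c)) (f (.inl d))) ∨
      ∃ i, TermOccurs (.var (.inl c)) (f (.inr i)) := by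
  have lift : ∀ {n m : ℕ} {φ : PredForm L α (n + 1)} {f : α ⊕ Fin n → L.Term (β ⊕ Fin m)},
      ((∃ d, φ.Occurs (.var d) ∧ TermOccurs (.var (.inl c)) (liftSubst f (.inl d))) ∨
        ∃ i, TermOccurs (.var (.inl c)) (liftSubst f (.inr i))) →
      (∃ d, φ.Occurs (.var d) ∧ TermOccurs (.var (.inl c)) (f (.inl d))) ∨
        ∃ i, TermOccurs (.var (.inl c)) (f (.inr i)) := by
    intro n m φ f h
    have key : ∀ t : L.Term (β ⊕ Fin m), TermOccurs (.var (.inl c))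
        (t.relabel (Sum.map id Fin.castSucc)) → TermOccurs (.var (.inl c)) t := by
      intro t ht
      obtain ⟨b | i, h₁, h₂⟩ := termOccurs_var_relabel ht
      · obtain rfl : c = b := Sum.inl.inj h₂
        exact h₁
      · cases h₂
    obtain ⟨d, h₁, h₂⟩ | ⟨i, hi⟩ := h
    · exact .inl ⟨d, h₁, key _ h₂⟩
    · induction i using Fin.lastCases with
      | last =>
        simp only [liftSubst, Sum.elim_inr, Fin.lastCases_last] at hi
        cases hi
      | cast i =>
        simp only [liftSubst, Sum.elim_inr, Fin.lastCases_castSucc] at hi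
        exact .inr ⟨i, key _ hi⟩
  induction φ generalizing m with
  | bot => exact h.elim
  | rel R ts =>
    obtain ⟨i, hi⟩ := h
    obtain ⟨d | j, h₁, h₂⟩ := termOccurs_var_subst hi
    · exact .inl ⟨d, ⟨i, h₁⟩, h₂⟩
    · exact .inr ⟨j, h₂⟩
  | neg a iha => exact iha h
  | and a b iha ihb =>
    exact h.elim (fun h => (iha h).imp_left fun ⟨d, h, h'⟩ => ⟨d, .inl h, h'⟩)
      fun h => (ihb h).imp_left fun ⟨d, h, h'⟩ => ⟨d, .inr h, h'⟩
  | or a b iha ihb =>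
    exact h.elim (fun h => (iha h).imp_left fun ⟨d, h, h'⟩ => ⟨d, .inl h, h'⟩)
      fun h => (ihb h).imp_left fun ⟨d, h, h'⟩ => ⟨d, .inr h, h'⟩
  | imp a b iha ihb =>
    exact h.elim (fun h => (iha h).imp_left fun ⟨d, h, h'⟩ => ⟨d, .inl h, h'⟩)
      fun h => (ihb h).imp_left fun ⟨d, h, h'⟩ => ⟨d, .inr h, h'⟩
  | iff a b iha ihb =>
    exact h.elim (fun h => (iha h).imp_left fun ⟨d, h, h'⟩ => ⟨d, .inl h, h'⟩)
      fun h => (ihb h).imp_left fun ⟨d, h, h'⟩ => ⟨d, .inr h, h'⟩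
  | all a iha => exact lift (φ := a) (iha h)
  | ex a iha => exact lift (φ := a) (iha h)

theorem occurs_var_inst {φ : PredForm L α 1} {t : L.Term α} {c : α}
    (h : (φ.inst t).Occurs (.var c)) : φ.Occurs (.var c) ∨ TermOccurs (.var c) t := by
  obtain ⟨d, h₁, h₂⟩ | ⟨i, hi⟩ := occurs_var_subst h
  · cases h₂
    exact .inl h₁
  · obtain ⟨a, h₁, h₂⟩ := termOccurs_var_relabel hi
    cases h₂
    exact .inr h₁

theorem not_occurs_var_substFree_elim (φ : PredForm L Empty 0) (c : β) :
    ¬ (φ.substFree (β := β) Empty.elim).Occurs (.var c) := by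
  intro h
  obtain ⟨d, -⟩ | ⟨i, -⟩ := occurs_var_subst h
  · exact d.elim
  · exact i.elim0

theorem term_subst_injective {n : ℕ} {f : Empty ⊕ Fin n → L.Term (β ⊕ Fin n)}
    (hf : ∀ i, f (.inr i) = .var (.inr i)) :
    Function.Injective fun t : L.Term (Empty ⊕ Fin n) => t.subst f := by
  intro s
  induction s with
  | var a =>
    obtain a | i := a
    · exact a.elim
    rintro ((b | j) | ⟨g, ts⟩) h
    · exact b.elim
    · simp only [FirstOrder.Language.Term.subst, hf] at h
      cases h; rfl
    · simp only [FirstOrder.Language.Term.subst, hf] at h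
      cases h
  | func g ts ih =>
    rintro ((b | j) | ⟨g', ts'⟩) h
    · exact b.elim
    · simp only [FirstOrder.Language.Term.subst, hf] at h
      cases h
    · simp only [FirstOrder.Language.Term.subst, FirstOrder.Language.Term.func.injEq] at h
      obtain ⟨rfl, h₁, h₂⟩ := h
      obtain rfl := eq_of_heq h₁
      congr 1
      exact funext fun i => ih i (congrFun (eq_of_heq h₂) i)

theorem liftSubst_var {n : ℕ} {f : Empty ⊕ Fin n → L.Term (β ⊕ Fin n)}
    (hf : ∀ i, f (.inr i) = .var (.inr i)) (i : Fin (n + 1)) :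
    liftSubst f (.inr i) = .var (.inr i) := by
  induction i using Fin.lastCases with
  | last => simp [liftSubst]
  | cast i => simp [liftSubst, hf, FirstOrder.Language.Term.relabel]

/-- Formulas without new constants stay distinct when read as formulas that may contain them. -/
theorem subst_injective {n : ℕ} {f : Empty ⊕ Fin n → L.Term (β ⊕ Fin n)}
    (hf : ∀ i, f (.inr i) = .var (.inr i)) :
    Function.Injective fun φ : PredForm L Empty n => φ.subst f := by
  intro φ
  induction φ with
  | bot => intro ψ h; cases ψ <;> first | rfl | cases h
  | rel R ts =>
    intro ψ h
    cases ψ with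
    | rel R' ts' =>
      simp only [subst, rel.injEq] at h
      obtain ⟨rfl, h₁, h₂⟩ := h
      obtain rfl := eq_of_heq h₁
      congr 1
      exact funext fun i => term_subst_injective hf (congrFun (eq_of_heq h₂) i)
    | _ => cases h
  | neg a iha =>
    intro ψ h
    cases ψ with
    | neg a' => exact congrArg neg (iha hf (neg.inj h))
    | _ => cases h
  | and a b iha ihb =>
    intro ψ h
    cases ψ with
    | and a' b' => exact congrArg₂ and (iha hf (and.inj h).1) (ihb hf (and.inj h).2)
    | _ => cases h
  | or a b iha ihb =>
    intro ψ h
    cases ψ with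
    | or a' b' => exact congrArg₂ or (iha hf (or.inj h).1) (ihb hf (or.inj h).2)
    | _ => cases h
  | imp a b iha ihb =>
    intro ψ h
    cases ψ with
    | imp a' b' => exact congrArg₂ imp (iha hf (imp.inj h).1) (ihb hf (imp.inj h).2)
    | _ => cases h
  | iff a b iha ihb =>
    intro ψ h
    cases ψ with
    | iff a' b' => exact congrArg₂ iff (iha hf (iff.inj h).1) (ihb hf (iff.inj h).2)
    | _ => cases h
  | all a iha =>
    intro ψ h
    cases ψ with
    | all a' => exact congrArg all (iha (liftSubst_var hf) (all.inj h))
    | _ => cases h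
  | ex a iha =>
    intro ψ h
    cases ψ with
    | ex a' => exact congrArg ex (iha (liftSubst_var hf) (ex.inj h))
    | _ => cases h

theorem predLogic_emb_injective : Function.Injective (predLogic L).emb :=
  subst_injective fun i => i.elim0

/-! ### Soundness of the rules of predicate logic -/

/-- A non-empty structure, as an interpretation of predicate logic. -/
structure Interpretation (L : FirstOrder.Language.{u, v}) where
  carrier : Type (max u v)
  [struct : L.Structure carrier]
  [nonempty : Nonempty carrier]

attribute [instance] Interpretation.struct Interpretation.nonempty

theorem sat_inst_update {M : Type w} [L.Structure M] {a : PredForm L ℕ 1} {c : ℕ}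
    (hc : ¬ a.Occurs (.var c)) (x : ℕ → M) (y : Fin 0 → M) (m : M) :
    (a.inst (.var c)).Sat (Function.update x c m) y ↔ a.Sat x (Fin.snoc y m) := by
  rw [sat_inst, FirstOrder.Language.Term.realize_var, Function.update_self]
  refine sat_congr fun d hd => Function.update_of_ne ?_ _ _
  rintro rfl
  exact hc hd

theorem sat_update_of_fresh {M : Type w} [L.Structure M] {Γ : Set (PredForm L ℕ 0)} {c : ℕ}
    (hc : Fresh Γ c) {χ : PredForm L ℕ 0} (hχ : χ ∈ Γ) (x : ℕ → M) (y : Fin 0 → M) (m : M) :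
    χ.Sat x y → χ.Sat (Function.update x c m) y := by
  refine (sat_congr fun d hd => ?_).1
  have hdc : d ≠ c := fun h => hc χ hχ (h ▸ hd)
  rw [Function.update_of_ne hdc]

/-- Semantics in non-empty structures.  The new constants are evaluated by assignments, and a rule
for an existential formula assigns a witness to its new constant. -/
def semantics (L : FirstOrder.Language.{u, v}) :
    Semantics.{max u v, max u v + 1, max u v} (predLogic L) where
  Interp := Interpretation L
  Assign M := ℕ → M.carrier
  sat M φ := φ.Sat (M := M.carrier) Empty.elim Fin.elim0
  satN M x φ := φ.Sat (M := M.carrier) x Fin.elim0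
  nonempty_assign _ := inferInstance
  entails_iff Γ φ := ⟨fun h M => h M.carrier, fun h M _ _ => h ⟨M⟩⟩
  satN_emb M x φ := sat_substFree_elim φ x _
  satN_neg _ _ _ := Iff.rfl
  not_satN_bot _ _ h := h
  linear M x Γ φ l hφ hl h := by
    cases hl with
    | and a b => exact ⟨x, fun _ _ h => h, by simpa [Sat] using h⟩
    | iff a b => exact ⟨x, fun _ _ h => h, by simpa [Sat, iff_iff_implies_and_implies] using h⟩
    | neg_or a b => exact ⟨x, fun _ _ h => h, by simpa [Sat] using h⟩
    | neg_imp a b => exact ⟨x, fun _ _ h => h, by simpa [Sat] using h⟩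
    | neg_neg a => exact ⟨x, fun _ _ h => h, by simpa [Sat] using h⟩
    | all a t _ =>
      refine ⟨x, fun _ _ h => h, ?_⟩
      simpa [sat_inst] using h _
    | ex a c hc =>
      obtain ⟨m, hm⟩ := h
      refine ⟨Function.update x c m, fun χ hχ => sat_update_of_fresh hc hχ _ _ _, ?_⟩
      simpa [sat_inst_update (hc _ hφ : ¬ a.Occurs _)] using hm
    | neg_all a c hc =>
      obtain ⟨m, hm⟩ := not_forall.1 h
      refine ⟨Function.update x c m, fun χ hχ => sat_update_of_fresh hc hχ _ _ _, ?_⟩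
      simpa [Sat, sat_inst_update (hc _ hφ : ¬ a.Occurs _)] using hm
    | neg_ex a t _ =>
      refine ⟨x, fun _ _ h => h, ?_⟩
      simpa [Sat, sat_inst] using not_exists.1 h _
  branching M x φ a b hab h := by
    cases hab <;> simp only [Sat] at h ⊢ <;> tauto

end PredForm

end

namespace PredForm

variable {L : FirstOrder.Language.{u, v}}

/-! ### Nodes with finitely many new constants -/

/-- Only finitely many new constants occur, so that there are fresh ones. -/
def FinitelyManyNew (Γ : Set (PredForm L ℕ 0)) : Prop :=
  {c : ℕ | ∃ χ ∈ Γ, χ.Occurs (.var c)}.Finite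

theorem FinitelyManyNew.exists_fresh {Γ : Set (PredForm L ℕ 0)} (h : FinitelyManyNew Γ) :
    ∃ c, Fresh Γ c := by
  obtain ⟨c, hc⟩ := h.exists_notMem
  exact ⟨c, fun χ hχ h => hc ⟨χ, hχ, h⟩⟩

theorem FinitelyManyNew.union {Γ Δ : Set (PredForm L ℕ 0)} (h : FinitelyManyNew Γ) {I : Set ℕ}
    (hI : I.Finite)
    (hΔ : ∀ χ ∈ Δ, ∀ c, χ.Occurs (.var c) → (∃ χ' ∈ Γ, χ'.Occurs (.var c)) ∨ c ∈ I) :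
    FinitelyManyNew (Γ ∪ Δ) := by
  refine (Set.Finite.union h hI).subset ?_
  rintro c ⟨χ, hχ | hχ, hc⟩
  · exact .inl ⟨χ, hχ, hc⟩
  · exact hΔ χ hχ c hc

/-- A rule introduces at most one new constant into a node: admissible terms occur in the node
already, or are constants. -/
theorem exists_const_of_linear {Γ : Set (PredForm L ℕ 0)} {φ : PredForm L ℕ 0}
    {l : List (PredForm L ℕ 0)} (hφ : φ ∈ Γ) (hl : Linear Γ φ l) :
    ∃ c₀ : ℕ, ∀ χ ∈ l, ∀ c, χ.Occurs (.var c) → (∃ χ' ∈ Γ, χ'.Occurs (.var c)) ∨ c = c₀ := by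
  have hsub : (∀ χ ∈ l, ∀ c : ℕ, χ.Occurs (.var c) → φ.Occurs (.var c)) →
      ∃ c₀ : ℕ, ∀ χ ∈ l, ∀ c, χ.Occurs (.var c) → (∃ χ' ∈ Γ, χ'.Occurs (.var c)) ∨ c = c₀ :=
    fun h => ⟨0, fun χ hχ c hc => .inl ⟨φ, hφ, h χ hχ c hc⟩⟩
  have hvar : ∀ {a : PredForm L ℕ 1} {c₀ c : ℕ}, (∀ d : ℕ, a.Occurs (.var d) → φ.Occurs (.var d)) →
      (a.inst (.var c₀)).Occurs (.var c) → (∃ χ' ∈ Γ, χ'.Occurs (.var c)) ∨ c = c₀ := by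
    intro a c₀ c ha hc
    obtain h | h := occurs_var_inst hc
    · exact .inl ⟨φ, hφ, ha c h⟩
    · cases h
      exact .inr rfl
  have hterm : ∀ {a : PredForm L ℕ 1} {t : L.Term ℕ}, Admissible Γ t →
      (∀ d : ℕ, a.Occurs (.var d) → φ.Occurs (.var d)) → ∃ c₀, ∀ c,
      (a.inst t).Occurs (.var c) → (∃ χ' ∈ Γ, χ'.Occurs (.var c)) ∨ c = c₀ := by
    rintro a t (⟨χ, hχ, ht⟩ | ⟨-, c₀, rfl⟩) ha
    · refine ⟨0, fun c hc => .inl ?_⟩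
      obtain h | h := occurs_var_inst hc
      · exact ⟨φ, hφ, ha c h⟩
      · exact ⟨χ, hχ, ht.of_termOccurs h⟩
    · exact ⟨c₀, fun c => hvar ha⟩
  cases hl with
  | and a b => exact hsub (by simp [Occurs]; tauto)
  | iff a b => exact hsub (by simp [Occurs]; tauto)
  | neg_or a b => exact hsub (by simp [Occurs]; tauto)
  | neg_imp a b => exact hsub (by simp [Occurs]; tauto)
  | neg_neg a => exact hsub (by simp [Occurs])
  | all a t ht => exact (hterm ht fun _ h => h).imp fun c₀ h => by simpa using h
  | ex a c₀ _ => exact ⟨c₀, by simpa using fun c => hvar fun _ h => h⟩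
  | neg_all a c₀ _ =>
    refine ⟨c₀, ?_⟩
    rw [List.forall_mem_singleton]
    exact fun c => hvar (a := a) fun _ h => h
  | neg_ex a t ht =>
    refine (hterm (a := a) ht fun _ h => h).imp fun c₀ h => ?_
    rw [List.forall_mem_singleton]
    exact h

theorem isInvariant_finitelyManyNew : IsInvariant (predLogic L) FinitelyManyNew where
  anti Γ Γ' h h' := Set.Finite.subset h' fun c ⟨χ, hχ, hc⟩ => ⟨χ, h hχ, hc⟩
  linear Γ φ l h hφ hl := by
    obtain ⟨c₀, hc₀⟩ := exists_const_of_linear hφ hl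
    exact h.union (Set.finite_singleton c₀) hc₀
  branching Γ φ a b h hφ hab := by
    have key : ∀ c ∈ ({a, b} : Set _), FinitelyManyNew (Γ ∪ {c}) := by
      refine fun χ hχ => h.union Set.finite_empty ?_
      rintro _ rfl d hd
      refine .inl ⟨φ, hφ, ?_⟩
      cases hab <;> obtain rfl | rfl := hχ <;> simp only [Occurs] at hd ⊢ <;> tauto
    exact ⟨key a (by simp), key b (by simp)⟩
  bot Γ h := h.union Set.finite_empty (by rintro _ rfl c hc; exact hc.elim)
  emb Γ X h := h.union Set.finite_empty (by
    rintro _ ⟨χ, -, rfl⟩ c hc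
    exact (not_occurs_var_substFree_elim χ c hc).elim)
  init X := by
    refine Set.finite_empty.subset ?_
    rintro c ⟨_, ⟨χ, -, rfl⟩ | ⟨χ, -, rfl⟩, hc⟩ <;>
      exact (not_occurs_var_substFree_elim χ c hc).elim

/-! ### Saturated sets of formulas of predicate logic have models -/

/-- What a saturated set of formulas has to satisfy because it contains the given formula: for an
optional term `t`, a universal formula has to be instantiated with `t`, and in the absence of `t`
with any term at all. -/
def Demand : PredForm L ℕ 0 → Option (L.Term ℕ) → Set (PredForm L ℕ 0) → Prop
  | and a b, _ => fun H => a ∈ H ∧ b ∈ H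
  | or a b, _ => fun H => a ∈ H ∨ b ∈ H
  | imp a b, _ => fun H => neg a ∈ H ∨ b ∈ H
  | iff a b, _ => fun H => imp a b ∈ H ∧ imp b a ∈ H
  | all a, none => fun H => ∃ t, a.inst t ∈ H
  | all a, some t => fun H => a.inst t ∈ H
  | ex a, _ => fun H => ∃ c : ℕ, a.inst (.var c) ∈ H
  | neg (and a b), _ => fun H => neg a ∈ H ∨ neg b ∈ H
  | neg (or a b), _ => fun H => neg a ∈ H ∧ neg b ∈ H
  | neg (imp a b), _ => fun H => a ∈ H ∧ neg b ∈ H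
  | neg (iff a b), _ => fun H => neg (imp a b) ∈ H ∨ neg (imp b a) ∈ H
  | neg (neg a), _ => fun H => a ∈ H
  | neg (all a), _ => fun H => ∃ c : ℕ, neg (a.inst (.var c)) ∈ H
  | neg (ex a), none => fun H => ∃ t, neg (a.inst t) ∈ H
  | neg (ex a), some t => fun H => neg (a.inst t) ∈ H
  | _, _ => fun _ => True

theorem monotone_demand (φ : PredForm L ℕ 0) (t : Option (L.Term ℕ)) : Monotone (φ.Demand t) := by
  intro H H' h
  unfold Demand
  split <;> simp only [le_Prop_eq] <;> grind

/-- The demands made by a set of formulas: universal formulas are to be instantiated with the terms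
that occur in it. -/
def activeDemands (H : Set (PredForm L ℕ 0)) : Set (PredForm L ℕ 0 × Option (L.Term ℕ)) :=
  {i | i.1 ∈ H ∧ ∀ t ∈ i.2, ∃ χ ∈ H, χ.Occurs t}

theorem monotone_activeDemands : Monotone (activeDemands (L := L)) :=
  fun _ _ h _ hi => ⟨h hi.1, fun t ht => (hi.2 t ht).imp fun _ hχ => ⟨h hχ.1, hχ.2⟩⟩

theorem finite_activeDemands {H : Set (PredForm L ℕ 0)} (h : H.Finite) :
    (activeDemands H).Finite := by
  have hocc : {t | ∃ χ ∈ H, χ.Occurs t}.Finite := by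
    refine (h.biUnion fun χ _ => finite_setOf_occurs χ).subset ?_
    rintro t ⟨χ, hχ, ht⟩
    exact Set.mem_biUnion hχ ht
  refine (h.prod ((Set.finite_singleton none).union (hocc.image some))).subset ?_
  rintro ⟨χ, _ | t⟩ ⟨hχ, ht⟩
  · exact ⟨hχ, .inl rfl⟩
  · exact ⟨hχ, .inr ⟨t, ht t rfl, rfl⟩⟩

theorem activeDemands_iUnion {B : ℕ → Set (PredForm L ℕ 0)} (hB : Monotone B) :
    activeDemands (⋃ n, B n) ⊆ ⋃ n, activeDemands (B n) := by
  rintro ⟨φ, t⟩ ⟨hφ, ht⟩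
  obtain ⟨n, hn⟩ := Set.mem_iUnion.1 hφ
  cases t with
  | none => exact Set.mem_iUnion.2 ⟨n, hn, by simp⟩
  | some t =>
    obtain ⟨χ, hχ, h⟩ := ht t rfl
    obtain ⟨m, hm⟩ := Set.mem_iUnion.1 hχ
    refine Set.mem_iUnion.2 ⟨max n m, hB (le_max_left n m) hn, ?_⟩
    rintro _ ⟨⟩
    exact ⟨χ, hB (le_max_right n m) hm, h⟩

/-- The domain of the term model of a set of formulas: the closed terms that occur in it, or a
single constant if there are none. -/
def termDomain (H : Set (PredForm L ℕ 0)) : Set (L.Term ℕ) :=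
  {t | (∃ χ ∈ H, χ.Occurs t) ∨ ((∀ χ ∈ H, ∀ s, ¬ χ.Occurs s) ∧ t = .var 0)}

theorem termDomain_nonempty (H : Set (PredForm L ℕ 0)) : (termDomain H).Nonempty := by
  by_cases h : ∃ t, ∃ χ ∈ H, χ.Occurs t
  · obtain ⟨t, ht⟩ := h
    exact ⟨t, .inl ht⟩
  · push Not at h
    exact ⟨.var 0, .inr ⟨fun χ hχ s => h s χ hχ, rfl⟩⟩

/-- The carrier of the term model, lifted to the universe of the interpretations. -/
def TermModel (H : Set (PredForm L ℕ 0)) : Type (max u v) := ULift.{v} (termDomain H)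

/-- A term as an element of the term model; terms outside of its domain are mapped to an arbitrary
element. -/
noncomputable def TermModel.mk (H : Set (PredForm L ℕ 0)) (t : L.Term ℕ) : TermModel H :=
  ⟨if h : t ∈ termDomain H then ⟨t, h⟩ else ⟨_, (termDomain_nonempty H).some_mem⟩⟩

/-- The term that an element of the term model is. -/
def TermModel.term {H : Set (PredForm L ℕ 0)} (m : TermModel H) : L.Term ℕ := m.down.1

theorem TermModel.term_mk {H : Set (PredForm L ℕ 0)} {t : L.Term ℕ} (h : t ∈ termDomain H) :
    (TermModel.mk H t).term = t := by
  simp [TermModel.mk, TermModel.term, h]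

theorem TermModel.ext {H : Set (PredForm L ℕ 0)} {m m' : TermModel H} (h : m.term = m'.term) :
    m = m' :=
  ULift.down_injective (Subtype.ext h)

noncomputable instance (H : Set (PredForm L ℕ 0)) : L.Structure (TermModel H) where
  funMap f ms := .mk H (.func f fun i => (ms i).term)
  RelMap R ms := rel R (fun i => (ms i).term.relabel Sum.inl) ∈ H

instance (H : Set (PredForm L ℕ 0)) : Nonempty (TermModel H) :=
  ⟨.mk H (.var 0)⟩

/-- Every new constant denotes itself. -/
noncomputable def TermModel.assign (H : Set (PredForm L ℕ 0)) (c : ℕ) : TermModel H :=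
  .mk H (.var c)

theorem TermModel.term_realize {H : Set (PredForm L ℕ 0)} {t : L.Term ℕ}
    (h : ∃ χ ∈ H, χ.Occurs t) : (t.realize (TermModel.assign H)).term = t := by
  induction t with
  | var c => exact term_mk (.inl h)
  | func f ts ih =>
    have hts : ∀ i, ((ts i).realize (TermModel.assign H)).term = ts i := fun i =>
      ih i (h.imp fun χ hχ => ⟨hχ.1, hχ.2.of_termOccurs
        (show TermOccurs (ts i) (.func f ts) from .inr ⟨i, .refl _⟩)⟩)
    have : (FirstOrder.Language.Term.func f ts).realize (TermModel.assign H) =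
        .mk H (.func f ts) := by
      refine congrArg (fun ss => TermModel.mk H (.func f ss)) (funext hts)
    rw [this]
    exact term_mk (.inl h)

/-- If no term occurs then the term model has one element, so that a single instance of a universal
formula is enough. -/
theorem TermModel.exists_realize_eq {H : Set (PredForm L ℕ 0)} {p : L.Term ℕ → Prop}
    (h : ∃ t, p t) (h' : ∀ t, (∃ χ ∈ H, χ.Occurs t) → p t) (m : TermModel H) :
    ∃ t, p t ∧ t.realize (TermModel.assign H) = m := by
  by_cases hm : ∃ χ ∈ H, χ.Occurs m.term
  · exact ⟨m.term, h' _ hm, TermModel.ext (TermModel.term_realize hm)⟩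
  · obtain ⟨t, ht⟩ := h
    refine ⟨t, ht, ?_⟩
    obtain hm' | ⟨hno, hm'⟩ := m.down.2
    · exact absurd hm' hm
    obtain ⟨χ, hχ, h⟩ | ⟨-, h⟩ := (t.realize (TermModel.assign H)).down.2
    · exact absurd h (hno χ hχ _)
    · exact TermModel.ext (h.trans hm'.symm)

theorem relMap_termModel {H : Set (PredForm L ℕ 0)} {k : ℕ} {R : L.Relations k}
    {ts : Fin k → L.Term (ℕ ⊕ Fin 0)}
    (h : ∃ χ ∈ H, ∀ i (t : L.Term ℕ), t.relabel Sum.inl = ts i → χ.Occurs t) :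
    (rel R ts).Sat (TermModel.assign H) Fin.elim0 ↔ rel R ts ∈ H := by
  let ss : Fin k → L.Term ℕ := fun i => (ts i).relabel (Sum.elim id Fin.elim0)
  have hss : ∀ i, (ss i).relabel Sum.inl = ts i := by
    intro i
    have : (Sum.inl ∘ Sum.elim id Fin.elim0 : ℕ ⊕ Fin 0 → ℕ ⊕ Fin 0) = id := by
      ext (a | j)
      · rfl
      · exact j.elim0
    simp only [ss, FirstOrder.Language.Term.relabel_relabel, this,
      FirstOrder.Language.Term.relabel_id]
  obtain ⟨χ, hχ, hocc⟩ := h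
  have hreal : ∀ i, ((ts i).realize (Sum.elim (TermModel.assign H) Fin.elim0)).term = ss i := by
    intro i
    rw [← hss i, FirstOrder.Language.Term.realize_relabel, Sum.elim_comp_inl]
    exact TermModel.term_realize ⟨χ, hχ, hocc i _ (hss i)⟩
  change rel R (fun i =>
    ((ts i).realize (Sum.elim (TermModel.assign H) Fin.elim0)).term.relabel Sum.inl) ∈ H ↔ _
  simp only [hreal, hss]

/-- Truth lemma for saturated sets. -/
theorem sat_of_demand {H : Set (PredForm L ℕ 0)} (hbot : bot ∉ H) (hneg : ∀ φ ∈ H, neg φ ∉ H)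
    (hH : ∀ i ∈ activeDemands H, i.1.Demand i.2 H) (φ : PredForm L ℕ 0) :
    (φ ∈ H → φ.Sat (TermModel.assign H) Fin.elim0) ∧
      (neg φ ∈ H → ¬ φ.Sat (TermModel.assign H) Fin.elim0) := by
  have hnone : ∀ φ ∈ H, φ.Demand none H := fun φ hφ => hH (φ, none) ⟨hφ, by simp⟩
  have hsome : ∀ φ ∈ H, ∀ t, (∃ χ ∈ H, χ.Occurs t) → φ.Demand (some t) H :=
    fun φ hφ t ht => hH (φ, some t) ⟨hφ, by simpa using ht⟩
  induction hk : φ.complexity using Nat.strong_induction_on generalizing φ with | _ k ihk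
  have h₁ := hnone φ
  have h₂ := hnone (neg φ)
  cases φ with
  | bot => exact ⟨fun h => absurd h hbot, fun _ h => h⟩
  | rel R ts =>
    constructor
    · intro h
      exact (relMap_termModel ⟨_, h, fun i t ht => ⟨i, ht ▸ .refl _⟩⟩).2 h
    · intro h h'
      refine hneg _ ?_ h
      exact (relMap_termModel ⟨_, h, fun i t ht => ⟨i, ht ▸ .refl _⟩⟩).1 h'
  | neg a =>
    have ha := ihk _ (by rw [← hk]; simp only [complexity]; omega) a rfl
    exact ⟨ha.2, fun h h' => h' (ha.1 (h₂ h))⟩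
  | and a b =>
    have ha := ihk _ (by rw [← hk]; simp only [complexity]; omega) a rfl
    have hb := ihk _ (by rw [← hk]; simp only [complexity]; omega) b rfl
    exact ⟨fun h => ⟨ha.1 (h₁ h).1, hb.1 (h₁ h).2⟩,
      fun h h' => (h₂ h).elim (fun h => ha.2 h h'.1) fun h => hb.2 h h'.2⟩
  | or a b =>
    have ha := ihk _ (by rw [← hk]; simp only [complexity]; omega) a rfl
    have hb := ihk _ (by rw [← hk]; simp only [complexity]; omega) b rfl
    exact ⟨fun h => (h₁ h).imp ha.1 hb.1, fun h h' => h'.elim (ha.2 (h₂ h).1) (hb.2 (h₂ h).2)⟩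
  | imp a b =>
    have ha := ihk _ (by rw [← hk]; simp only [complexity]; omega) a rfl
    have hb := ihk _ (by rw [← hk]; simp only [complexity]; omega) b rfl
    exact ⟨fun h h' => (h₁ h).elim (fun h => absurd h' (ha.2 h)) hb.1,
      fun h h' => hb.2 (h₂ h).2 (h' (ha.1 (h₂ h).1))⟩
  | iff a b =>
    have ha := ihk _ (by rw [← hk]; simp only [complexity]; omega) (imp a b) rfl
    have hb := ihk _ (by rw [← hk]; simp only [complexity]; omega) (imp b a) rfl
    exact ⟨fun h => ⟨ha.1 (h₁ h).1, hb.1 (h₁ h).2⟩,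
      fun h h' => (h₂ h).elim (fun h => ha.2 h h'.1) fun h => hb.2 h h'.2⟩
  | all a =>
    have ih := fun t => ihk _ (by rw [← hk, complexity_inst]; simp only [complexity]; omega)
      (a.inst t) rfl
    simp only [sat_inst] at ih
    constructor
    · intro h m
      obtain ⟨t, ht, rfl⟩ := TermModel.exists_realize_eq (p := fun t => a.inst t ∈ H)
        (h₁ h) (hsome _ h) m
      exact (ih t).1 ht
    · intro h h'
      obtain ⟨c, hc⟩ : ∃ c : ℕ, neg (a.inst (.var c)) ∈ H := h₂ h
      exact (ih _).2 hc (h' _)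
  | ex a =>
    have ih := fun t => ihk _ (by rw [← hk, complexity_inst]; simp only [complexity]; omega)
      (a.inst t) rfl
    simp only [sat_inst] at ih
    constructor
    · intro h
      obtain ⟨c, hc⟩ : ∃ c : ℕ, a.inst (.var c) ∈ H := h₁ h
      exact ⟨_, (ih _).1 hc⟩
    · rintro h ⟨m, hm⟩
      obtain ⟨t, ht, rfl⟩ := TermModel.exists_realize_eq (p := fun t => neg (a.inst t) ∈ H)
        (h₂ h) (hsome _ h) m
      exact (ih t).2 ht hm

/-! ### Completeness of the rules of predicate logic -/

theorem exists_admissible (Γ : Set (PredForm L ℕ 0)) : ∃ t, Admissible Γ t := by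
  by_cases h : ∃ t, ∃ χ ∈ Γ, χ.Occurs t
  · obtain ⟨t, ht⟩ := h
    exact ⟨t, .inl ht⟩
  · push Not at h
    exact ⟨.var 0, .inr ⟨fun χ hχ s => h s χ hχ, 0, rfl⟩⟩

theorem exists_isOpenSet_demand {A : Set (Mark (PredForm L Empty 0))} {B : Set (PredForm L ℕ 0)}
    (hB : IsOpenSet (predLogic L) FinitelyManyNew A B) {φ : PredForm L ℕ 0}
    {t : Option (L.Term ℕ)} (hi : (φ, t) ∈ activeDemands B) :
    ∃ B', B ⊆ B' ∧ IsOpenSet (predLogic L) FinitelyManyNew A B' ∧ φ.Demand t B' := by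
  obtain ⟨hφ, ht⟩ := hi
  have hlin : ∀ p : List (PredForm L ℕ 0) → Prop,
      (∀ Γ, FinitelyManyNew Γ → B ⊆ Γ → ∃ l, p l ∧ Linear Γ φ l) → ∃ B', B ⊆ B' ∧
      IsOpenSet (predLogic L) FinitelyManyNew A B' ∧ ∃ l, p l ∧ ∀ χ ∈ l, χ ∈ B' := by
    intro p hp
    obtain ⟨l, hpl, h⟩ := hB.exists_linear isInvariant_finitelyManyNew hφ hp
    exact ⟨_, Set.subset_union_left, h, l, hpl, fun χ hχ => .inr hχ⟩
  have hlin' : ∀ l, (∀ Γ, Linear Γ φ l) → ∃ B', B ⊆ B' ∧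
      IsOpenSet (predLogic L) FinitelyManyNew A B' ∧ ∀ χ ∈ l, χ ∈ B' := by
    intro l hl
    simpa using hlin (· = l) fun Γ _ _ => ⟨l, rfl, hl Γ⟩
  have hbr : ∀ a b, Branching φ a b → ∃ B', B ⊆ B' ∧
      IsOpenSet (predLogic L) FinitelyManyNew A B' ∧ (a ∈ B' ∨ b ∈ B') := by
    intro a b hab
    obtain h | h := hB.branching isInvariant_finitelyManyNew hφ hab
    · exact ⟨_, Set.subset_union_left, h, .inl (.inr rfl)⟩
    · exact ⟨_, Set.subset_union_left, h, .inr (.inr rfl)⟩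
  have hadm : ∀ Γ, B ⊆ Γ → ∀ s ∈ t, Admissible Γ s :=
    fun Γ hΓ s hs => .inl ((ht s hs).imp fun χ hχ => ⟨hΓ hχ.1, hχ.2⟩)
  unfold Demand
  split
  · simpa using hlin' _ fun _ => .and _ _
  · exact hbr _ _ (.or _ _)
  · exact hbr _ _ (.imp _ _)
  · simpa using hlin' _ fun _ => .iff _ _
  · rename_i a
    simpa using hlin (fun l => ∃ t, l = [a.inst t]) fun Γ _ _ =>
      (exists_admissible Γ).elim fun t ht => ⟨_, ⟨t, rfl⟩, .all a t ht⟩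
  · rename_i a s
    simpa using hlin (· = [a.inst s]) fun Γ _ hΓ => ⟨_, rfl, .all a s (hadm Γ hΓ s rfl)⟩
  · rename_i a
    simpa using hlin (fun l => ∃ c : ℕ, l = [a.inst (.var c)]) fun Γ hg _ =>
      hg.exists_fresh.elim fun c hc => ⟨_, ⟨c, rfl⟩, .ex a c hc⟩
  · exact hbr _ _ (.neg_and _ _)
  · simpa using hlin' _ fun _ => .neg_or _ _
  · simpa using hlin' _ fun _ => .neg_imp _ _
  · exact hbr _ _ (.neg_iff _ _)
  · simpa using hlin' _ fun _ => .neg_neg _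
  · rename_i a
    simpa using hlin (fun l => ∃ c : ℕ, l = [neg (a.inst (.var c))]) fun Γ hg _ =>
      hg.exists_fresh.elim fun c hc => ⟨_, ⟨c, rfl⟩, .neg_all a c hc⟩
  · rename_i a
    simpa using hlin (fun l => ∃ t, l = [neg (a.inst t)]) fun Γ _ _ =>
      (exists_admissible Γ).elim fun t ht => ⟨_, ⟨t, rfl⟩, .neg_ex a t ht⟩
  · rename_i a s
    simpa using hlin (· = [neg (a.inst s)]) fun Γ _ hΓ =>
      ⟨_, rfl, .neg_ex a s (hadm Γ hΓ s rfl)⟩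
  · exact ⟨B, subset_rfl, hB, trivial⟩

theorem isComplete_predLogic : IsComplete (predLogic L) FinitelyManyNew := by
  refine isComplete_of_isOpenSet fun A X φ hφ hopen => ?_
  obtain ⟨B, hmono, hB₀, hB, hH⟩ := exists_saturated_sequence (active := activeDemands)
    (sat := fun i => i.1.Demand i.2) (fun B hB => finite_activeDemands hB.1)
    monotone_activeDemands (fun i => monotone_demand i.1 i.2)
    (fun _ h => activeDemands_iUnion h) (fun B i hB hi => exists_isOpenSet_demand hB hi) hopen
  have hsub : B 0 ⊆ ⋃ n, B n := Set.subset_iUnion B 0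
  rw [hB₀] at hsub
  obtain ⟨hbot, hneg⟩ := IsOpenSet.iUnion hmono hB
  have htruth := sat_of_demand hbot hneg hH
  refine (htruth _).2 (hsub (.inr rfl)) ((sat_substFree_elim φ _ _).2 ?_)
  exact hφ (TermModel (⋃ n, B n)) fun χ hχ =>
    (sat_substFree_elim χ _ _).1 ((htruth _).1 (hsub (.inl ⟨χ, hχ, rfl⟩)))

end PredForm

end ArgTab

theorem mainTheorem1 :
    (∀ (P : Type w) (K : Set (ArgTab.PropForm P)) (D : Set (ArgTab.Rule (ArgTab.PropForm P))),
      (∀ (S : Finset (ArgTab.Elem (ArgTab.PropForm P))) (ψ : ArgTab.Stmt (ArgTab.PropForm P)),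
        ArgTab.IsMinimalArgument (ArgTab.propLogic P) K D S ψ →
          ArgTab.Derivable (ArgTab.propLogic P) K D (ArgTab.testsFor D ψ) S ψ) ∧
      (∀ (Q : Set (ArgTab.PropForm P)) (S : Finset (ArgTab.Elem (ArgTab.PropForm P)))
          (ψ : ArgTab.Stmt (ArgTab.PropForm P)),
        ArgTab.Derivable (ArgTab.propLogic P) K D Q S ψ →
          ArgTab.IsArgument (ArgTab.propLogic P) K D S ψ)) ∧
    (∀ (L : FirstOrder.Language.{u, v}) (K : Set (ArgTab.PredForm L Empty 0))
        (D : Set (Σ n, ArgTab.OpenRule L n)),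
      (∀ (S : Finset (ArgTab.Elem (ArgTab.PredForm L Empty 0)))
          (ψ : ArgTab.Stmt (ArgTab.PredForm L Empty 0)),
        ArgTab.IsMinimalArgument (ArgTab.predLogic L) K (ArgTab.groundInstances D) S ψ →
          ArgTab.Derivable (ArgTab.predLogic L) K (ArgTab.groundInstances D)
            (ArgTab.testsFor (ArgTab.groundInstances D) ψ) S ψ) ∧
      (∀ (Q : Set (ArgTab.PredForm L Empty 0))
          (S : Finset (ArgTab.Elem (ArgTab.PredForm L Empty 0)))
          (ψ : ArgTab.Stmt (ArgTab.PredForm L Empty 0)),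
        ArgTab.Derivable (ArgTab.predLogic L) K (ArgTab.groundInstances D) Q S ψ →
          ArgTab.IsArgument (ArgTab.predLogic L) K (ArgTab.groundInstances D) S ψ)) := by
  refine ⟨fun P K D => ⟨fun S ψ h => ?_, fun Q S ψ h => ?_⟩,
    fun L K D => ⟨fun S ψ h => ?_, fun Q S ψ h => ?_⟩⟩
  · exact ArgTab.derivable_of_isMinimalArgument (ArgTab.PropForm.semantics P)
      ArgTab.PropForm.isInvariant_true ArgTab.PropForm.isComplete_propLogic h
  · exact (ArgTab.PropForm.semantics P).isArgument_of_derivable Function.injective_id h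
  · exact ArgTab.derivable_of_isMinimalArgument (ArgTab.PredForm.semantics L)
      ArgTab.PredForm.isInvariant_finitelyManyNew ArgTab.PredForm.isComplete_predLogic h
  · exact (ArgTab.PredForm.semantics L).isArgument_of_derivable
      ArgTab.PredForm.predLogic_emb_injective h
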